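/- Let $d\ge 1$, $\mathbb R^+=[0,\infty)$, and for $h\ge 0$ let $(S(n))_{n\ge 0}$ under $P_h$ be the nearest-neighbor random walk on $\mathbb Z^d$ started at $0$ with drift $h$ along the first axis: under $P_0$ it is the simple random walk, and the law of $(S(0),\dots,S(n))$ under $P_h$ has density $e^{hS_1(n)}/E_0[e^{hS_1(n)}]$ with respect to its law under $P_0$, where $S_1$ is the first coordinate of $S$. Let $\varphi:\mathbb R^+\to\mathbb R^+$ be concave and increasing with $\lim_{t\to 0}\varphi(t)=\varphi(0)=0$, $\lim_{t\to\infty}\varphi(t)=\infty$ and $\lim_{t\to\infty}\varphi(t)/t=0$. For $\beta\ge 0$ put $\Phi_\beta(N)=\sum_{x\in\mathbb Z^d}\varphi(\beta\,\ell_x(N))$ with $\ell_x(N)=\#\{1\le n\le N: S(n)=x\}$. The path $(S(0),\dots,S(N))$ is a bridge if $S_1(0)<S_1(n)\le S_1(N)$ for $n=1,\dots,N$. Define $$G_{h,\beta}(N)=E_h[e^{-\Phi_\beta(N)}],\qquad B_{h,\beta}(N)=E_h\big[e^{-\Phi_\beta(N)};\ (S(0),\dots,S(N))\text{ is a bridge}\big],$$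 $$m_G(h,\beta)=\lim_{N\to\infty}\frac{-\log G_{h,\beta}(N)}{N},\qquad K_{h,\beta}=\Big(\sum_{n=0}^\infty\frac{P_h[S_1(n)=0]}{B_{h,\beta}(n)}\Big)^2\in[0,\infty].$$ For $h>0$, $\beta\ge0$ and $L\in\mathbb N$ let $\overline G_{h,\beta}(L)=\sum_{N\ge 1}E_h[e^{-\Phi_\beta(N)};\,S_1(N)=L]$ and $\overline m_G(h,\beta)=\lim_{L\to\infty}-\frac1L\log\overline G_{h,\beta}(L)$, and let $\overline m_G(0,\beta)$ be the continuous extension to $h=0$. For $h>0$ the critical parameter $\beta_c(h)>0$ is the unique solution of $\overline m_G(0,\beta_c(h))=h$ (that it exists and is unique is part of the claim). Then the following hold. (a) For all $h,\beta\ge 0$ the limit $m_B(h,\beta)=\lim_{N\to\infty}\frac{-\log B_{h,\beta}(N)}{N}$ exists and lies in $[0,\varphi(\beta)]$, the function $m_B$ is continuous on $\mathbb R^+\times\mathbb R^+$, and $B_{h,\beta}(N)\le e^{-m_B(h,\beta)N}$ for all $N\in\mathbb N=\{1,2,\dots\}$. (b) For $h>0$ and $0\le\beta<\beta_c(h)$,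 the limit $m_G(h,\beta)$ exists and $m_B(h,\beta)=m_G(h,\beta)$. (c) For $h>0$ and $0\le\beta_0<\beta_c(h)$ we have $K_{h,\beta_0}<\infty$, and for all $0\le\beta\le\beta_0$ and $N\in\mathbb N$, $$B_{h,\beta}(N)\ge\frac{e^{-m_B(h,\beta)N}}{K_{h,\beta_0}},\qquad G_{h,\beta}(N)\ge\frac{e^{-m_G(h,\beta)N}}{K_{h,\beta_0}}.$$ -/

import Mathlib

open Filter Topology Set
open scoped ENNReal

namespace DriftedWalk

/-- The `2 d` admissible steps of a nearest-neighbor walk on `ℤ^d`: `(i, true)` stands for the unit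
vector `e_i`, `(i, false)` for `-e_i`. -/
abbrev Step (d : ℕ) : Type := Fin d × Bool

/-- The lattice vector belonging to a step. -/
def Step.vec {d : ℕ} (s : Step d) : Fin d → ℤ :=
  if s.2 then Pi.single s.1 1 else -Pi.single s.1 1

/-- The position `S(n) ∈ ℤ^d` at time `n ≤ N` of the walk started at the origin whose successive
increments are `s 0, …, s (N - 1)`. -/
def pos {d N : ℕ} (s : Fin N → Step d) (n : ℕ) : Fin d → ℤ :=
  ∑ k : Fin N with k.val < n, (s k).vec

/-- The first component `S_1(n)` of the walk. -/
def pos₁ {d N : ℕ} [NeZero d] (s : Fin N → Step d) (n : ℕ) : ℤ := pos s n 0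

/-- `E_0[f(S[N])]`: expectation of a function of the first `N` steps of the simple random walk,
all `(2 d)^N` step sequences being equally likely. -/
noncomputable def expect₀ (d N : ℕ) (f : (Fin N → Step d) → ℝ) : ℝ :=
  (∑ s : Fin N → Step d, f s) / (2 * d : ℝ) ^ N

/-- `E_h[f(S[N])]`: expectation for the walk with drift `h` in the direction of the first axis.
The density of the law of `S[N]` with respect to the one of the simple random walk is
`exp (h * S_1(N)) / E_0[exp (h * S_1(N))]`. -/
noncomputable def expect (d : ℕ) [NeZero d] (h : ℝ) (N : ℕ) (f : (Fin N → Step d) → ℝ) : ℝ :=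
  expect₀ d N (fun s => Real.exp (h * pos₁ s N) * f s) /
    expect₀ d N (fun s => Real.exp (h * pos₁ s N))

/-- The assumptions on `φ : ℝ⁺ → ℝ⁺`, where `ℝ⁺ = [0, ∞)`; values of `φ` at negative arguments
play no role. -/
structure IsPotential (φ : ℝ → ℝ) : Prop where
  nonneg : ∀ t, 0 ≤ t → 0 ≤ φ t
  concave : ConcaveOn ℝ (Ici 0) φ
  mono : MonotoneOn φ (Ici 0)
  map_zero : φ 0 = 0
  tendsto_zero : Tendsto φ (𝓝[>] 0) (𝓝 0)
  tendsto_top : Tendsto φ atTop atTop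
  sublinear : Tendsto (fun t => φ t / t) atTop (𝓝 0)

/-- The local time `ℓ_x(N) = #{1 ≤ n ≤ N : S(n) = x}`. -/
def localTime {d N : ℕ} (s : Fin N → Step d) (x : Fin d → ℤ) : ℕ :=
  ((Finset.Icc 1 N).filter (fun n => pos s n = x)).card

/-- The path potential `Φ_β(N) = ∑_{x ∈ ℤ^d} φ(β ℓ_x(N))`. As `φ 0 = 0`, only the finitely many
visited sites contribute. -/
noncomputable def pathPotential {d N : ℕ} (φ : ℝ → ℝ) (β : ℝ) (s : Fin N → Step d) : ℝ :=
  ∑ᶠ x : Fin d → ℤ, φ (β * localTime s x)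

/-- `S[N] = (S(0), …, S(N))` is a bridge: `S_1(0) < S_1(n) ≤ S_1(N)` for `n = 1, …, N`. -/
def IsBridge {d N : ℕ} [NeZero d] (s : Fin N → Step d) : Prop :=
  ∀ n : ℕ, 1 ≤ n → n ≤ N → pos₁ s 0 < pos₁ s n ∧ pos₁ s n ≤ pos₁ s N

/-- `G_{h,β}(N) = E_h[exp (-Φ_β(N))]`. -/
noncomputable def G (d : ℕ) [NeZero d] (φ : ℝ → ℝ) (h β : ℝ) (N : ℕ) : ℝ :=
  expect d h N (fun s => Real.exp (-pathPotential φ β s))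

/-- `B_{h,β}(N) = E_h[exp (-Φ_β(N)); S[N] is a bridge]`. -/
noncomputable def B (d : ℕ) [NeZero d] (φ : ℝ → ℝ) (h β : ℝ) (N : ℕ) : ℝ :=
  expect d h N ({s | IsBridge s}.indicator (fun s => Real.exp (-pathPotential φ β s)))

/-- `m_G(h, β) = lim_{N → ∞} -log G_{h,β}(N) / N` (meaningful once the limit is known to exist). -/
noncomputable def pathMass (d : ℕ) [NeZero d] (φ : ℝ → ℝ) (h β : ℝ) : ℝ :=
  limUnder atTop (fun N : ℕ => -Real.log (G d φ h β N) / N)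

/-- `m_B(h, β) = lim_{N → ∞} -log B_{h,β}(N) / N` (meaningful once the limit is known to exist). -/
noncomputable def bridgeMass (d : ℕ) [NeZero d] (φ : ℝ → ℝ) (h β : ℝ) : ℝ :=
  limUnder atTop (fun N : ℕ => -Real.log (B d φ h β N) / N)

/-- The point-to-hyperplane partition function
`∑_{N ≥ 1} E_h[exp (-Φ_β(N)); S_1(N) = L]`, used for `h > 0` and `L ≥ 1` only; there the series
converges because the walk is transient in the first direction. -/
noncomputable def Gbar (d : ℕ) [NeZero d] (φ : ℝ → ℝ) (h β : ℝ) (L : ℕ) : ℝ :=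
  ∑' N : ℕ, expect d h (N + 1)
    ({s | pos₁ s (N + 1) = (L : ℤ)}.indicator (fun s => Real.exp (-pathPotential φ β s)))

/-- `m` is the point-to-hyperplane mass `h ↦ lim_{L → ∞} -log Gbar_{h,β}(L) / L` at `β`. The limit
is taken for `h > 0`, and the mass is extended to `h = 0` by continuity. -/
def IsHyperplaneMass (d : ℕ) [NeZero d] (φ : ℝ → ℝ) (β : ℝ) (m : ℝ → ℝ) : Prop :=
  ContinuousOn m (Ici 0) ∧
    ∀ h : ℝ, 0 < h →
      Tendsto (fun L : ℕ => -Real.log (Gbar d φ h β L) / L) atTop (𝓝 (m h))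

/-- `βc` is the critical parameter `β_c(h)`: `βc > 0`, and the point-to-hyperplane mass at
`(0, βc)` equals `h`. -/
def IsCriticalParameter (d : ℕ) [NeZero d] (φ : ℝ → ℝ) (h βc : ℝ) : Prop :=
  0 < βc ∧ ∃ m : ℝ → ℝ, IsHyperplaneMass d φ βc m ∧ m 0 = h

/-- `P_h[S_1(n) = 0]`. -/
noncomputable def returnProb (d : ℕ) [NeZero d] (h : ℝ) (n : ℕ) : ℝ :=
  expect d h n ({s | pos₁ s n = 0}.indicator (fun _ => 1))

/-- `K_{h,β} = (∑_{n ≥ 0} P_h[S_1(n) = 0] / B_{h,β}(n))²`, as an element of `[0, ∞]`. -/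
noncomputable def K (d : ℕ) [NeZero d] (φ : ℝ → ℝ) (h β : ℝ) : ℝ≥0∞ :=
  (∑' n : ℕ, ENNReal.ofReal (returnProb d h n) / ENNReal.ofReal (B d φ h β n)) ^ 2

end DriftedWalk

/-!
All quantities reduce to weighted sums over the finitely many nearest-neighbor paths of a given
length, with weight `k(S₁(N)) e^{-Φ_β(N)}`; paths are encoded as lists of steps, so that they can be
concatenated and cut. As `φ` is subadditive, `Φ_β` is subadditive under concatenation; it is
monotone, and additive over parts of a path that visit disjoint sets of sites.

Three facts about cutting paths carry the proof. A concatenation of bridges is a bridge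
(`bridgeSum_mul_le`). A path that ends at level `≥ 0` consists of a return to level `0`, a bridge,
and a return to the final level (`pathSum_le`): cut at the last visit to level `0` and then at the
first visit to the final level. A bridge cut at a given time consists of a bridge, two returns, and
a bridge that stays above the first one (`bridgeSum_add_le`).

Hence `B` is supermultiplicative and Fekete's lemma gives `m_B`. With `λ_h = log E_0[e^{h S₁(1)}]`,
returns have probability at most `e^{-λ_h n}`. So if `m_B(h, β) < λ_h`, then
`Q = ∑ₙ P_h[S₁(n) = 0] / B(n)` is finite, `Q² B` is submultiplicative, which is the lower bound in
terms of `K = Q²`, and `G ≤ Q² B + e^{-λ_h N}`, which gives `m_G = m_B`.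

To relate this to the critical parameter, let `M(λ, β)` (`planeMass`) be the decay rate in `L` of
the generating function `∑_N e^{-λ N} E_0[e^{-Φ_β(N)}; S₁(N) = L]`, for paths or, equivalently,
bridges. The point-to-hyperplane mass at `h > 0` is `M(λ_h, β) - h`, and its value at `h = 0` is
`M(0+, β) = inf_{λ > 0} M(λ, β)` (`planeMassZero`). By convexity of `exp` and concavity of `φ`, `M`
is jointly concave; it is at least `φ(β)`, because a path reaching level `L` visits at least
`L` sites; and `M(λ, β) ≤ M(λ + φ(β), 0)` with `M(λ_h, 0) ≤ h`, because the walk with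
drift `h` visits every level. So `M(0+, ·)` is a strictly increasing, continuous and unbounded function on
`(0, ∞)` with limit `0` at `0`, and `β_c(h)` exists and is unique. If `m_B(h, β) ≥ λ_h`, then
`e^{h L} E_0[e^{-Φ_β(N)}; bridge, S₁(N) = L] ≤ 1` for all `N` and `L`, hence `M(λ, β) ≥ h` for all
`λ > 0`. So `β < β_c(h)`, that is `M(0+, β) < h`, implies `m_B(h, β) < λ_h`
(`bridgeMass_lt_log_stepMgf`).

At `β = 0` one has `G = 1`, so `m_B(h, 0) = 0` for `h > 0` and then for `h = 0`. Continuity of `m_B`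
follows since `m_B(h, β) - λ_h` is `1`-Lipschitz in `h` and `Φ_{cβ} ≤ c Φ_β` for `c ≥ 1`.
-/

namespace DriftedWalk

/-! ### The potential of a finite family of visits -/

section Potential

variable {φ : ℝ → ℝ}

lemma IsPotential.mul_le (hφ : IsPotential φ) {a t : ℝ} (ha0 : 0 ≤ a) (ha : a ≤ 1) (ht : 0 ≤ t) :
    a * φ t ≤ φ (a * t) := by
  have := hφ.concave.2 (x := t) (y := 0) ht (by simp) ha0 (sub_nonneg.2 ha) (by ring)
  simpa [hφ.map_zero] using this

lemma IsPotential.scale_le (hφ : IsPotential φ) {c t : ℝ} (hc : 1 ≤ c) (ht : 0 ≤ t) :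
    φ (c * t) ≤ c * φ t := by
  have hc0 : 0 < c := by linarith
  have := hφ.mul_le (a := c⁻¹) (t := c * t) (by positivity) (inv_le_one_of_one_le₀ hc)
    (by positivity)
  rw [inv_mul_cancel_left₀ hc0.ne', inv_mul_le_iff₀ hc0] at this
  exact this

lemma IsPotential.add_le (hφ : IsPotential φ) {a b : ℝ} (ha : 0 ≤ a) (hb : 0 ≤ b) :
    φ (a + b) ≤ φ a + φ b := by
  rcases (add_nonneg ha hb).eq_or_lt with h | h
  · have h1 : a = 0 := by linarith
    have h2 : b = 0 := by linarith
    simp [h1, h2, hφ.map_zero]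
  · have e1 := hφ.mul_le (a := a / (a + b)) (t := a + b) (by positivity)
      (by rw [div_le_one h]; linarith) h.le
    have e2 := hφ.mul_le (a := b / (a + b)) (t := a + b) (by positivity)
      (by rw [div_le_one h]; linarith) h.le
    rw [div_mul_cancel₀ _ h.ne'] at e1 e2
    have : a / (a + b) * φ (a + b) + b / (a + b) * φ (a + b) = φ (a + b) := by
      field_simp
    linarith

lemma IsPotential.tendsto_zero_right (hφ : IsPotential φ) : Tendsto φ (𝓝[≥] 0) (𝓝 0) := by
  have : Tendsto φ (pure 0 ⊔ 𝓝[>] (0 : ℝ)) (𝓝 0) := by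
    refine Tendsto.sup ?_ hφ.tendsto_zero
    simpa [hφ.map_zero] using tendsto_pure_nhds φ (0 : ℝ)
  rwa [← nhdsWithin_insert, Ioi_insert] at this

variable {α : Type*} [DecidableEq α]

/-- The potential `∑_x φ(β ℓ_x)` of a list of visited sites, `ℓ_x` being the number of occurrences
of the site `x` in the list. -/
noncomputable def sitePot (φ : ℝ → ℝ) (β : ℝ) (V : List α) : ℝ :=
  ∑ x ∈ V.toFinset, φ (β * V.count x)

lemma sitePot_eq_sum (hφ : IsPotential φ) (β : ℝ) {V : List α} {T : Finset α}
    (hT : V.toFinset ⊆ T) : sitePot φ β V = ∑ x ∈ T, φ (β * V.count x) := by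
  refine Finset.sum_subset hT fun x _ hx => ?_
  rw [List.mem_toFinset] at hx
  simp [List.count_eq_zero_of_not_mem hx, hφ.map_zero]

lemma sitePot_nonneg (hφ : IsPotential φ) {β : ℝ} (hβ : 0 ≤ β) (V : List α) :
    0 ≤ sitePot φ β V :=
  Finset.sum_nonneg fun _ _ => hφ.nonneg _ (by positivity)

lemma sitePot_map {γ : Type*} [DecidableEq γ] (φ : ℝ → ℝ) (β : ℝ) {f : α → γ}
    (hf : Function.Injective f) (V : List α) : sitePot φ β (V.map f) = sitePot φ β V := by
  have : (V.map f).toFinset = V.toFinset.image f := by ext; simp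
  rw [sitePot, this, Finset.sum_image hf.injOn, sitePot]
  exact Finset.sum_congr rfl fun x _ => by rw [List.count_map_of_injective V f hf]

lemma sitePot_append_le (hφ : IsPotential φ) {β : ℝ} (hβ : 0 ≤ β) (V W : List α) :
    sitePot φ β (V ++ W) ≤ sitePot φ β V + sitePot φ β W := by
  rw [sitePot_eq_sum hφ β (V := V) (T := (V ++ W).toFinset) (by simp),
    sitePot_eq_sum hφ β (V := W) (T := (V ++ W).toFinset) (by simp),
    sitePot, ← Finset.sum_add_distrib]
  refine Finset.sum_le_sum fun x _ => ?_
  rw [List.count_append, Nat.cast_add, mul_add]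
  exact hφ.add_le (by positivity) (by positivity)

lemma sitePot_append_of_disjoint (hφ : IsPotential φ) (β : ℝ) {V W : List α}
    (hVW : V.Disjoint W) : sitePot φ β (V ++ W) = sitePot φ β V + sitePot φ β W := by
  rw [sitePot_eq_sum hφ β (V := V) (T := (V ++ W).toFinset) (by simp),
    sitePot_eq_sum hφ β (V := W) (T := (V ++ W).toFinset) (by simp),
    sitePot, ← Finset.sum_add_distrib]
  refine Finset.sum_congr rfl fun x _ => ?_
  rw [List.count_append]
  by_cases hx : x ∈ V
  · simp [List.count_eq_zero_of_not_mem (hVW hx), hφ.map_zero]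
  · simp [List.count_eq_zero_of_not_mem hx, hφ.map_zero]

lemma sitePot_mono_sublist (hφ : IsPotential φ) {β : ℝ} (hβ : 0 ≤ β) {V W : List α}
    (h : V.Sublist W) : sitePot φ β V ≤ sitePot φ β W := by
  rw [sitePot_eq_sum hφ β (V := V) (T := W.toFinset)
    (fun x hx => by simpa using h.subset (by simpa using hx)), sitePot]
  refine Finset.sum_le_sum fun x _ => hφ.mono (by simp; positivity) (by simp; positivity) ?_
  gcongr
  exact h.count_le x

lemma sitePot_le_length (hφ : IsPotential φ) {β : ℝ} (hβ : 0 ≤ β) (V : List α) :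
    sitePot φ β V ≤ V.length * φ β := by
  induction V with
  | nil => simp [sitePot]
  | cons x V ih =>
    have := sitePot_append_le hφ hβ [x] V
    have h1 : sitePot φ β [x] = φ β := by simp [sitePot]
    simp only [List.singleton_append] at this
    push_cast [List.length_cons]
    linarith

lemma card_le_sitePot (hφ : IsPotential φ) {β : ℝ} (hβ : 0 ≤ β) (V : List α) :
    V.toFinset.card * φ β ≤ sitePot φ β V := by
  rw [← nsmul_eq_mul]
  refine Finset.card_nsmul_le_sum _ _ _ fun x hx => hφ.mono hβ (by simp; positivity) ?_
  have : 1 ≤ V.count x := List.one_le_count_iff.2 (by simpa using hx)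
  exact le_mul_of_one_le_right hβ (by exact_mod_cast this)

lemma sitePot_mono (hφ : IsPotential φ) {β β' : ℝ} (hβ : 0 ≤ β) (h : β ≤ β') (V : List α) :
    sitePot φ β V ≤ sitePot φ β' V :=
  Finset.sum_le_sum fun x _ => hφ.mono (by simp; positivity)
    (by simp only [mem_Ici]; have := hβ.trans h; positivity) (by gcongr)

lemma sitePot_scale_le (hφ : IsPotential φ) {β c : ℝ} (hβ : 0 ≤ β) (hc : 1 ≤ c) (V : List α) :
    sitePot φ (c * β) V ≤ c * sitePot φ β V := by
  rw [sitePot, sitePot, Finset.mul_sum]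
  exact Finset.sum_le_sum fun x _ => by
    rw [mul_assoc]; exact hφ.scale_le hc (by positivity)

lemma sitePot_concave (hφ : IsPotential φ) (V : List α) {s t β β' : ℝ}
    (hs : 0 ≤ s) (ht : 0 ≤ t) (hst : s + t = 1) (hβ : 0 ≤ β) (hβ' : 0 ≤ β') :
    s * sitePot φ β V + t * sitePot φ β' V ≤ sitePot φ (s * β + t * β') V := by
  rw [sitePot, sitePot, Finset.mul_sum, Finset.mul_sum, ← Finset.sum_add_distrib]
  refine Finset.sum_le_sum fun x _ => ?_
  have := hφ.concave.2 (x := β * V.count x) (y := β' * V.count x) (by simp; positivity)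
    (by simp; positivity) hs ht hst
  simp only [smul_eq_mul] at this
  convert this using 2
  ring

lemma sitePot_zero (hφ : IsPotential φ) (V : List α) : sitePot φ 0 V = 0 := by
  simp [sitePot, hφ.map_zero]

end Potential

/-! ### Paths as lists of steps -/

section Paths

variable {d : ℕ}

/-- The endpoint of the path with step list `l`. -/
def endpoint (l : List (Step d)) : Fin d → ℤ := (l.map Step.vec).sum

/-- The first coordinate of the endpoint of the path with step list `l`. -/
def height [NeZero d] (l : List (Step d)) : ℤ := endpoint l 0

/-- The sites visited at times `1, …, N` by the path with the `N` steps in `l`, in order. -/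
def visits : List (Step d) → List (Fin d → ℤ)
  | [] => []
  | s :: l => s.vec :: (visits l).map (s.vec + ·)

/-- The bridge condition for lists of steps. -/
def BridgeList [NeZero d] (l : List (Step d)) : Prop :=
  ∀ n, 1 ≤ n → n ≤ l.length → 0 < height (l.take n) ∧ height (l.take n) ≤ height l

@[simp] lemma endpoint_nil : endpoint ([] : List (Step d)) = 0 := rfl

@[simp] lemma endpoint_append (u v : List (Step d)) :
    endpoint (u ++ v) = endpoint u + endpoint v := by simp [endpoint]

@[simp] lemma height_nil [NeZero d] : height ([] : List (Step d)) = 0 := rfl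

@[simp] lemma height_append [NeZero d] (u v : List (Step d)) :
    height (u ++ v) = height u + height v := by simp [height]

lemma visits_append (u v : List (Step d)) :
    visits (u ++ v) = visits u ++ (visits v).map (endpoint u + ·) := by
  induction u with
  | nil => simp [visits]
  | cons s u ih =>
    simp only [List.cons_append, visits, ih, List.map_append, List.map_map]
    congr 3
    ext x : 1
    simp [endpoint, add_assoc]

lemma visits_eq (l : List (Step d)) :
    visits l = (List.range l.length).map fun n => endpoint (l.take (n + 1)) := by
  induction l with
  | nil => rfl
  | cons s l ih =>
    rw [visits, ih, List.length_cons, List.range_succ_eq_map]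
    simp [endpoint, Function.comp_def]

@[simp] lemma length_visits (l : List (Step d)) : (visits l).length = l.length := by
  simp [visits_eq]

lemma mem_visits {l : List (Step d)} {x : Fin d → ℤ} :
    x ∈ visits l ↔ ∃ n, 1 ≤ n ∧ n ≤ l.length ∧ endpoint (l.take n) = x := by
  simp only [visits_eq, List.mem_map, List.mem_range]
  constructor
  · rintro ⟨n, hn, rfl⟩
    exact ⟨n + 1, by omega, hn, rfl⟩
  · rintro ⟨n, h1, hn, rfl⟩
    exact ⟨n - 1, by omega, by rw [Nat.sub_add_cancel h1]⟩

lemma pos_eq_endpoint {N : ℕ} (s : Fin N → Step d) (n : ℕ) :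
    pos s n = endpoint ((List.ofFn s).take n) := by
  rw [endpoint, List.map_take, List.map_ofFn, List.sum_take_ofFn]
  rfl

lemma pos₁_eq_height [NeZero d] {N : ℕ} (s : Fin N → Step d) (n : ℕ) :
    pos₁ s n = height ((List.ofFn s).take n) := by
  rw [pos₁, pos_eq_endpoint, height]

lemma pos₁_self [NeZero d] {N : ℕ} (s : Fin N → Step d) :
    pos₁ s N = height (List.ofFn s) := by
  rw [pos₁_eq_height, List.take_of_length_le (by simp)]

lemma localTime_eq_count {N : ℕ} (s : Fin N → Step d) (x : Fin d → ℤ) :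
    localTime s x = (visits (List.ofFn s)).count x := by
  have h1 : localTime s x
      = ((Finset.range N).filter (fun n => pos s (n + 1) = x)).card := by
    rw [localTime]
    refine (Finset.card_bij (fun n _ => n + 1) ?_ ?_ ?_).symm
    · intro n hn
      simp only [Finset.mem_filter, Finset.mem_range, Finset.mem_Icc] at hn ⊢
      exact ⟨by omega, hn.2⟩
    · intro a _ b _ h
      simpa using h
    · intro b hb
      simp only [Finset.mem_filter, Finset.mem_range, Finset.mem_Icc] at hb ⊢
      refine ⟨b - 1, ⟨by omega, ?_⟩, by omega⟩
      rw [Nat.sub_add_cancel hb.1.1]; exact hb.2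
  rw [h1, visits_eq, List.length_ofFn]
  simp only [pos_eq_endpoint]
  suffices H : ∀ (M : ℕ) (f : ℕ → Fin d → ℤ), ((Finset.range M).filter (fun n => f n = x)).card
      = ((List.range M).map f).count x from H N _
  intro M f
  induction M with
  | zero => simp
  | succ M ih =>
    rw [List.range_succ, Finset.range_add_one, Finset.filter_insert]
    split_ifs with h <;> simp [ih, h]

lemma pathPotential_eq {φ : ℝ → ℝ} (hφ : IsPotential φ) (β : ℝ) {N : ℕ} (s : Fin N → Step d) :
    pathPotential φ β s = sitePot φ β (visits (List.ofFn s)) := by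
  rw [pathPotential, finsum_eq_sum_of_support_subset
    (s := (visits (List.ofFn s)).toFinset)]
  · simp only [localTime_eq_count, sitePot]
  · intro x hx
    by_contra h
    apply hx
    simp only [List.coe_toFinset, mem_ofPred_eq] at h
    simp [localTime_eq_count, List.count_eq_zero_of_not_mem h, hφ.map_zero]

lemma isBridge_iff [NeZero d] {N : ℕ} (s : Fin N → Step d) :
    IsBridge s ↔ BridgeList (List.ofFn s) := by
  simp only [IsBridge, BridgeList, pos₁_self, pos₁_eq_height, List.length_ofFn, List.take_zero,
    height_nil]

lemma abs_height_singleton_le [NeZero d] (s : Step d) : |height [s]| ≤ 1 := by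
  obtain ⟨i, b⟩ := s
  by_cases hi : i = 0 <;> cases b <;> simp [height, endpoint, Step.vec, hi]

/-- The potential `Φ_β` of the path with step list `l`. -/
noncomputable def pot (φ : ℝ → ℝ) (β : ℝ) (l : List (Step d)) : ℝ := sitePot φ β (visits l)

variable {φ : ℝ → ℝ} {β : ℝ}

lemma pot_append_le (hφ : IsPotential φ) (hβ : 0 ≤ β) (u v : List (Step d)) :
    pot φ β (u ++ v) ≤ pot φ β u + pot φ β v := by
  rw [pot, visits_append]
  refine (sitePot_append_le hφ hβ _ _).trans_eq ?_
  rw [sitePot_map φ β (add_right_injective _)]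
  rfl

/-- Omitting an initial and a final part of a path lowers its potential. -/
lemma pot_middle_le (hφ : IsPotential φ) (hβ : 0 ≤ β) (u v w : List (Step d)) :
    pot φ β v ≤ pot φ β (u ++ (v ++ w)) := by
  rw [pot, pot, visits_append, visits_append,
    ← sitePot_map φ β (add_right_injective (endpoint u)) (visits v), List.map_append]
  exact sitePot_mono_sublist hφ hβ
    ((List.sublist_append_left _ _).trans (List.sublist_append_right _ _))

/-- The sum of `f u * g v` over all ways to cut the path `l` into two pieces `u` and `v`. -/
def cutSum (f g : List (Step d) → ℝ) (l : List (Step d)) : ℝ :=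
  ∑ p ∈ Finset.HasAntidiagonal.antidiagonal l.length, f (l.take p.1) * g (l.drop p.1)

lemma le_cutSum {f g : List (Step d) → ℝ} (hf : ∀ l, 0 ≤ f l) (hg : ∀ l, 0 ≤ g l)
    {l : List (Step d)} {a : ℕ} (ha : a ≤ l.length) :
    f (l.take a) * g (l.drop a) ≤ cutSum f g l :=
  Finset.single_le_sum (f := fun p : ℕ × ℕ => f (l.take p.1) * g (l.drop p.1))
    (fun _ _ => mul_nonneg (hf _) (hg _))
    (Finset.HasAntidiagonal.mem_antidiagonal.2 (Nat.add_sub_cancel' ha) : (a, l.length - a) ∈ _)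

lemma cutSum_nonneg {f g : List (Step d) → ℝ} (hf : ∀ l, 0 ≤ f l) (hg : ∀ l, 0 ≤ g l)
    (l : List (Step d)) : 0 ≤ cutSum f g l :=
  Finset.sum_nonneg fun _ _ => mul_nonneg (hf _) (hg _)

lemma pot_nonneg (hφ : IsPotential φ) (hβ : 0 ≤ β) (l : List (Step d)) : 0 ≤ pot φ β l :=
  sitePot_nonneg hφ hβ _

lemma exp_neg_pot_le_one (hφ : IsPotential φ) (hβ : 0 ≤ β) (l : List (Step d)) :
    Real.exp (-pot φ β l) ≤ 1 :=
  Real.exp_le_one_iff.2 (neg_nonpos.2 (pot_nonneg hφ hβ l))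

end Paths

/-! ### Cutting paths at levels -/

section Cutting

variable {d : ℕ} [NeZero d]

lemma abs_height_take_succ_sub_le (l : List (Step d)) (n : ℕ) :
    |height (l.take (n + 1)) - height (l.take n)| ≤ 1 := by
  rcases lt_or_ge n l.length with h | h
  · rw [List.take_add_one, List.getElem?_eq_getElem h, Option.toList_some, height_append,
      add_sub_cancel_left]
    exact abs_height_singleton_le l[n]
  · rw [List.take_of_length_le h, List.take_of_length_le (by omega)]
    simp

/-- Discrete intermediate value theorem: on its way up the walk skips no level. -/
lemma exists_height_take_eq (l : List (Step d)) {n m : ℕ} {c : ℤ} (hnm : n ≤ m)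
    (hn : height (l.take n) ≤ c) (hm : c ≤ height (l.take m)) :
    ∃ k, n ≤ k ∧ k ≤ m ∧ height (l.take k) = c := by
  induction m, hnm using Nat.le_induction with
  | base => exact ⟨n, le_rfl, le_rfl, le_antisymm hn hm⟩
  | succ m hnm ih =>
    rcases le_or_gt c (height (l.take m)) with h | h
    · obtain ⟨k, h1, h2, h3⟩ := ih h
      exact ⟨k, h1, by omega, h3⟩
    · have := (abs_le.1 (abs_height_take_succ_sub_le l m)).2
      exact ⟨m + 1, by omega, le_rfl, by omega⟩

lemma height_drop (l : List (Step d)) (n : ℕ) :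
    height (l.drop n) = height l - height (l.take n) := by
  have := height_append (l.take n) (l.drop n)
  rw [List.take_append_drop] at this
  omega

lemma height_take_drop (l : List (Step d)) (a n : ℕ) :
    height ((l.drop a).take n) = height (l.take (a + n)) - height (l.take a) := by
  rw [List.take_add, height_append]
  ring

/-- After its last visit to level `0`, a path that ends at level `≥ 0` stays strictly above `0`. -/
lemma exists_last_zero {l : List (Step d)} (hl : 0 ≤ height l) :
    ∃ a ≤ l.length, height (l.take a) = 0 ∧
      ∀ n, 1 ≤ n → n ≤ (l.drop a).length → 0 < height ((l.drop a).take n) := by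
  set a := Nat.findGreatest (fun n => height (l.take n) = 0) l.length with ha
  have ha0 : height (l.take a) = 0 :=
    Nat.findGreatest_spec (P := fun n => height (l.take n) = 0) (m := 0) (by omega) (by simp)
  refine ⟨a, Nat.findGreatest_le _, ha0, fun n h1 hn => ?_⟩
  rw [List.length_drop] at hn
  rw [height_take_drop, ha0, sub_zero]
  by_contra! h
  obtain ⟨k, hk1, hk2, hk⟩ := exists_height_take_eq l (n := a + n) (m := l.length) (c := 0)
    (by omega) h (by simpa using hl)
  have : k ≤ a := Nat.le_findGreatest hk2 hk
  omega

/-- A path ending at level `≥ 0` stays below its final level until it first reaches it. -/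
lemma exists_first_top {l : List (Step d)} (hl : 0 ≤ height l) :
    ∃ b ≤ l.length, height (l.take b) = height l ∧
      ∀ n ≤ b, height (l.take n) ≤ height l := by
  have hex : ∃ n, height (l.take n) = height l := ⟨l.length, by simp⟩
  classical
  refine ⟨Nat.find hex, Nat.find_le (by simp), Nat.find_spec hex, fun n hn => ?_⟩
  by_contra! h
  obtain ⟨k, -, hk2, hk⟩ := exists_height_take_eq l (n := 0) (m := n) (c := height l)
    (Nat.zero_le _) (by simpa using hl) h.le
  have : Nat.find hex ≤ k := Nat.find_le hk
  have : n = k := by omega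
  subst this
  omega

lemma BridgeList.height_nonneg {l : List (Step d)} (hl : BridgeList l) : 0 ≤ height l := by
  rcases Nat.eq_zero_or_pos l.length with h | h
  · rw [List.length_eq_zero_iff] at h; simp [h]
  · simpa using (hl l.length h le_rfl).1.le

lemma BridgeList.append {u v : List (Step d)} (hu : BridgeList u) (hv : BridgeList v) :
    BridgeList (u ++ v) := by
  intro n h1 hn
  rw [List.length_append] at hn
  rw [List.take_append, height_append, height_append]
  have h0 := hu.height_nonneg
  have h0' := hv.height_nonneg
  rcases le_or_gt n u.length with h | h
  · have := hu n h1 h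
    rw [Nat.sub_eq_zero_of_le h, List.take_zero, height_nil]
    omega
  · have := hv (n - u.length) (by omega) (by omega)
    rw [List.take_of_length_le h.le]
    omega

variable {φ : ℝ → ℝ} {β : ℝ}

/-- The potential of a path is at least the sum of the potentials of an initial part `u` and a
final part `v`, if `v` moves strictly above the levels reached by `u`. -/
lemma pot_add_pot_le (hφ : IsPotential φ) (hβ : 0 ≤ β) {u w v : List (Step d)}
    (hu : ∀ n ≤ u.length, height (u.take n) ≤ height u + height w)
    (hv : ∀ n, 1 ≤ n → n ≤ v.length → 0 < height (v.take n)) :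
    pot φ β u + pot φ β v ≤ pot φ β (u ++ (w ++ v)) := by
  have key : (visits u).Disjoint ((visits v).map (endpoint (u ++ w) + ·)) := by
    intro x hx hx'
    obtain ⟨y, hy, rfl⟩ := List.mem_map.1 hx'
    obtain ⟨n, -, hn, he⟩ := mem_visits.1 hx
    obtain ⟨m, hm1, hm, rfl⟩ := mem_visits.1 hy
    have e := congrFun he 0
    have h1 := hu n hn
    have h2 := hv m hm1 hm
    simp only [height] at h1 h2
    simp only [endpoint_append, Pi.add_apply] at e
    omega
  rw [pot, pot, pot, ← sitePot_map φ β (add_right_injective (endpoint (u ++ w))) (visits v),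
    ← sitePot_append_of_disjoint hφ β key, ← List.append_assoc, visits_append, visits_append]
  refine sitePot_mono_sublist hφ hβ (List.Sublist.append ?_ (List.Sublist.refl _))
  exact List.sublist_append_left _ _

lemma height_mul_le_pot (hφ : IsPotential φ) (hβ : 0 ≤ β) (l : List (Step d)) :
    height l * φ β ≤ pot φ β l := by
  rcases le_or_gt (height l) 0 with h | h
  · refine le_trans ?_ (sitePot_nonneg hφ hβ _)
    exact mul_nonpos_of_nonpos_of_nonneg (by exact_mod_cast h) (hφ.nonneg _ hβ)
  refine le_trans ?_ (card_le_sitePot hφ hβ _)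
  refine mul_le_mul_of_nonneg_right ?_ (hφ.nonneg _ hβ)
  have hsub : Finset.Icc 1 (height l) ⊆ (visits l).toFinset.image (fun x => x 0) := by
    intro c hc
    rw [Finset.mem_Icc] at hc
    obtain ⟨k, -, hk2, hk⟩ := exists_height_take_eq l (n := 0) (m := l.length) (c := c)
      (Nat.zero_le _) (by simp; omega) (by simpa using hc.2)
    refine Finset.mem_image.2 ⟨_, List.mem_toFinset.2 (mem_visits.2 ⟨k, ?_, hk2, rfl⟩), hk⟩
    rcases Nat.eq_zero_or_pos k with rfl | h0
    · simp at hk; omega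
    · exact h0
  have h1 := (Finset.card_le_card hsub).trans Finset.card_image_le
  rw [Int.card_Icc] at h1
  have h2 : height l ≤ ((visits l).toFinset.card : ℤ) := by omega
  exact_mod_cast h2

/-- The weight `k(S₁(N)) e^{-Φ_β}` on bridges, `0` on other paths. -/
noncomputable def bridgeWt (φ : ℝ → ℝ) (β : ℝ) (k : ℤ → ℝ) : List (Step d) → ℝ :=
  {l | BridgeList l}.indicator fun l => k (height l) * Real.exp (-pot φ β l)

/-- The indicator of the paths that end in the hyperplane they started from. -/
def retInd (l : List (Step d)) : ℝ := if height l = 0 then 1 else 0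

lemma retInd_nonneg (l : List (Step d)) : 0 ≤ retInd l := by
  unfold retInd; split_ifs <;> simp

lemma bridgeWt_nonneg {k : ℤ → ℝ} (hk : ∀ x, 0 ≤ k x) (l : List (Step d)) :
    0 ≤ bridgeWt φ β k l :=
  indicator_nonneg (fun _ _ => mul_nonneg (hk _) (Real.exp_pos _).le) _

lemma bridgeWt_of_bridge (k : ℤ → ℝ) {l : List (Step d)} (hl : BridgeList l) :
    bridgeWt φ β k l = k (height l) * Real.exp (-pot φ β l) :=
  indicator_of_mem (show l ∈ {l | BridgeList l} from hl) _

lemma bridgeWt_of_not_bridge (k : ℤ → ℝ) {l : List (Step d)} (hl : ¬ BridgeList l) :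
    bridgeWt φ β k l = 0 :=
  indicator_of_notMem (show l ∉ {l | BridgeList l} from hl) _

lemma bridgeWt_mul_le (hφ : IsPotential φ) (hβ : 0 ≤ β) {k₁ k₂ k₃ : ℤ → ℝ}
    (hk₃ : ∀ x, 0 ≤ k₃ x) (hk : ∀ x y, k₁ x * k₂ y ≤ k₃ (x + y)) (u v : List (Step d)) :
    bridgeWt φ β k₁ u * bridgeWt φ β k₂ v ≤ bridgeWt φ β k₃ (u ++ v) := by
  by_cases hu : BridgeList u
  swap
  · rw [bridgeWt_of_not_bridge _ hu, zero_mul]; exact bridgeWt_nonneg hk₃ _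
  by_cases hv : BridgeList v
  swap
  · rw [bridgeWt_of_not_bridge _ hv, mul_zero]; exact bridgeWt_nonneg hk₃ _
  rw [bridgeWt_of_bridge _ hu, bridgeWt_of_bridge _ hv, bridgeWt_of_bridge _ (hu.append hv),
    mul_mul_mul_comm, ← Real.exp_add, height_append]
  refine mul_le_mul (hk _ _) (Real.exp_le_exp.2 ?_) (Real.exp_pos _).le (hk₃ _)
  have := pot_append_le hφ hβ u v
  linarith

/-- A path ending at level `≥ 0` consists of a return to level `0`, a bridge, and a return to the
final level. -/
lemma weight_le_cutSum (hφ : IsPotential φ) (hβ : 0 ≤ β) {k : ℤ → ℝ} (hk : ∀ x, 0 ≤ k x)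
    {l : List (Step d)} (hl : 0 ≤ height l) :
    k (height l) * Real.exp (-pot φ β l) ≤
      cutSum retInd (cutSum (bridgeWt φ β k) retInd) l := by
  obtain ⟨a, ha, ha0, hpos⟩ := exists_last_zero hl
  have hd : height (l.drop a) = height l := by rw [height_drop, ha0, sub_zero]
  obtain ⟨b, hb, hb0, htop⟩ := exists_first_top (l := l.drop a) (by omega)
  have hbr : BridgeList ((l.drop a).take b) := by
    intro n h1 hn
    rw [List.length_take] at hn
    rw [List.take_take, min_eq_left (by omega : n ≤ b), hb0]
    exact ⟨hpos n h1 (by omega), htop n (by omega)⟩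
  refine le_trans ?_ (le_cutSum retInd_nonneg
    (cutSum_nonneg (bridgeWt_nonneg hk) retInd_nonneg) ha)
  rw [retInd, if_pos ha0, one_mul]
  refine le_trans ?_ (le_cutSum (bridgeWt_nonneg hk) retInd_nonneg hb)
  rw [retInd, if_pos (by rw [height_drop, hb0, sub_self]), mul_one, bridgeWt_of_bridge _ hbr,
    hb0, hd]
  refine mul_le_mul_of_nonneg_left (Real.exp_le_exp.2 (neg_le_neg ?_)) (hk _)
  have := pot_middle_le hφ hβ (l.take a) ((l.drop a).take b) ((l.drop a).drop b)
  rwa [List.take_append_drop, List.take_append_drop] at this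

/-- Cut at an intermediate time, a bridge consists of a bridge and a return to the level reached
at that time, followed by another return to that level and another bridge. -/
lemma bridgeWt_append_le (hφ : IsPotential φ) (hβ : 0 ≤ β) {k k₁ k₂ : ℤ → ℝ}
    (hk₁ : ∀ x, 0 ≤ k₁ x) (hk₂ : ∀ x, 0 ≤ k₂ x) (hk : ∀ x y, k (x + y) ≤ k₁ x * k₂ y)
    (u v : List (Step d)) :
    bridgeWt φ β k (u ++ v) ≤
      cutSum (bridgeWt φ β k₁) retInd u * cutSum retInd (bridgeWt φ β k₂) v := by
  by_cases h : BridgeList (u ++ v)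
  swap
  · rw [bridgeWt_of_not_bridge _ h]
    exact mul_nonneg (cutSum_nonneg (bridgeWt_nonneg hk₁) retInd_nonneg _)
      (cutSum_nonneg retInd_nonneg (bridgeWt_nonneg hk₂) _)
  have hu : ∀ n, 1 ≤ n → n ≤ u.length → 0 < height (u.take n) := by
    intro n h1 hn
    have := (h n h1 (by rw [List.length_append]; omega)).1
    rwa [List.take_append_of_le_length hn] at this
  have hv : ∀ n ≤ v.length, height (v.take n) ≤ height v := by
    intro n hn
    rcases Nat.eq_zero_or_pos (u.length + n) with h0 | h0
    · have e1 : u = [] := List.length_eq_zero_iff.1 (by omega)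
      have e2 : n = 0 := by omega
      subst e1 e2
      simpa using h.height_nonneg
    have := (h (u.length + n) h0 (by rw [List.length_append]; omega)).2
    rw [List.take_length_add_append, height_append, height_append] at this
    omega
  have hu0 : 0 ≤ height u := by
    rcases Nat.eq_zero_or_pos u.length with h0 | h0
    · rw [List.length_eq_zero_iff.1 h0]; simp
    · simpa using (hu _ h0 le_rfl).le
  have hv0 : 0 ≤ height v := by simpa using hv 0 (Nat.zero_le _)
  obtain ⟨b, hb, hb0, htop⟩ := exists_first_top hu0
  obtain ⟨a, ha, ha0, hpos⟩ := exists_last_zero hv0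
  have hbr₁ : BridgeList (u.take b) := by
    intro n h1 hn
    rw [List.length_take] at hn
    rw [List.take_take, min_eq_left (by omega : n ≤ b), hb0]
    exact ⟨hu n h1 (by omega), htop n (by omega)⟩
  have hbr₂ : BridgeList (v.drop a) := by
    intro n h1 hn
    refine ⟨hpos n h1 hn, ?_⟩
    rw [List.length_drop] at hn
    rw [height_take_drop, height_drop]
    have := hv (a + n) (by omega)
    omega
  have hr₁ : height (u.drop b) = 0 := by rw [height_drop, hb0, sub_self]
  have hd : height (v.drop a) = height v := by rw [height_drop, ha0, sub_zero]
  refine le_trans ?_ (mul_le_mul (le_cutSum (bridgeWt_nonneg hk₁) retInd_nonneg hb)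
    (le_cutSum retInd_nonneg (bridgeWt_nonneg hk₂) ha)
    (mul_nonneg (retInd_nonneg _) (bridgeWt_nonneg hk₂ _))
    (cutSum_nonneg (bridgeWt_nonneg hk₁) retInd_nonneg _))
  rw [bridgeWt_of_bridge _ h, bridgeWt_of_bridge _ hbr₁, bridgeWt_of_bridge _ hbr₂, retInd,
    if_pos hr₁, retInd, if_pos ha0, mul_one, one_mul, mul_mul_mul_comm, ← Real.exp_add, hb0, hd,
    height_append]
  refine mul_le_mul (hk _ _) (Real.exp_le_exp.2 ?_) (Real.exp_pos _).le
    (mul_nonneg (hk₁ _) (hk₂ _))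
  have := pot_add_pot_le hφ hβ (u := u.take b) (w := u.drop b ++ v.take a) (v := v.drop a)
    (fun n hn => by
      rw [List.length_take] at hn
      rw [List.take_take, min_eq_left (by omega : n ≤ b), height_append, hb0, hr₁, ha0]
      have := htop n (by omega)
      omega) hpos
  rw [List.append_assoc, List.take_append_drop, ← List.append_assoc, List.take_append_drop] at this
  linarith

end Cutting

/-! ### Expectations over simple random walk paths -/

section Expectation

variable {d : ℕ}

/-- The expectation `E_0[f]` of a function of the first `N` steps of the simple random walk, where
`f` is defined on lists of steps of any length. -/
noncomputable def walkExp (d N : ℕ) (f : List (Step d) → ℝ) : ℝ :=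
  expect₀ d N fun s => f (List.ofFn s)

lemma walkExp_zero (f : List (Step d) → ℝ) : walkExp d 0 f = f [] := by
  simp [walkExp, expect₀]

lemma walkExp_add (a b : ℕ) (f : List (Step d) → ℝ) :
    walkExp d (a + b) f = walkExp d a fun u => walkExp d b fun v => f (u ++ v) := by
  simp only [walkExp, expect₀]
  rw [← Finset.sum_div, div_div, ← pow_add, add_comm b a, ← (Fin.appendEquiv a b).sum_comp,
    Fintype.sum_prod_type]
  congr 1
  refine Finset.sum_congr rfl fun u _ => Finset.sum_congr rfl fun v _ => ?_
  rw [← List.ofFn_fin_append]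
  rfl

lemma walkExp_mono {N : ℕ} {f g : List (Step d) → ℝ} (h : ∀ l, l.length = N → f l ≤ g l) :
    walkExp d N f ≤ walkExp d N g :=
  div_le_div_of_nonneg_right (Finset.sum_le_sum fun _ _ => h _ (List.length_ofFn))
    (by positivity)

lemma walkExp_congr {N : ℕ} {f g : List (Step d) → ℝ} (h : ∀ l, l.length = N → f l = g l) :
    walkExp d N f = walkExp d N g :=
  le_antisymm (walkExp_mono fun l hl => (h l hl).le) (walkExp_mono fun l hl => (h l hl).ge)

lemma walkExp_nonneg {N : ℕ} {f : List (Step d) → ℝ} (h : ∀ l, 0 ≤ f l) : 0 ≤ walkExp d N f :=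
  div_nonneg (Finset.sum_nonneg fun _ _ => h _) (by positivity)

lemma walkExp_const_mul (N : ℕ) (c : ℝ) (f : List (Step d) → ℝ) :
    walkExp d N (fun l => c * f l) = c * walkExp d N f := by
  simp only [walkExp, expect₀, ← Finset.mul_sum, mul_div_assoc]

lemma walkExp_mul_const (N : ℕ) (c : ℝ) (f : List (Step d) → ℝ) :
    walkExp d N (fun l => f l * c) = walkExp d N f * c := by
  simp only [mul_comm _ c, walkExp_const_mul]

lemma walkExp_sum {ι : Type*} (N : ℕ) (T : Finset ι) (f : ι → List (Step d) → ℝ) :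
    walkExp d N (fun l => ∑ i ∈ T, f i l) = ∑ i ∈ T, walkExp d N (f i) := by
  simp only [walkExp, expect₀]
  rw [Finset.sum_comm, Finset.sum_div]

lemma walkExp_add_fun (N : ℕ) (f g : List (Step d) → ℝ) :
    walkExp d N (fun l => f l + g l) = walkExp d N f + walkExp d N g := by
  simp only [walkExp, expect₀, Finset.sum_add_distrib, add_div]

lemma walkExp_const [NeZero d] (N : ℕ) (c : ℝ) : walkExp d N (fun _ => c) = c := by
  have : (d : ℝ) ≠ 0 := Nat.cast_ne_zero.2 (NeZero.ne d)
  simp only [walkExp, expect₀, Finset.sum_const, Finset.card_univ, nsmul_eq_mul, Fintype.card_fun,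
    Fintype.card_prod, Fintype.card_fin, Fintype.card_bool]
  push_cast
  rw [mul_comm (d : ℝ) 2]
  field_simp

lemma walkExp_mul (a b : ℕ) (f g : List (Step d) → ℝ) :
    (walkExp d a fun u => walkExp d b fun v => f u * g v) = walkExp d a f * walkExp d b g := by
  simp only [walkExp_const_mul, walkExp_mul_const]

lemma walkExp_cutSum (N : ℕ) (f g : List (Step d) → ℝ) :
    walkExp d N (cutSum f g) =
      ∑ p ∈ Finset.HasAntidiagonal.antidiagonal N, walkExp d p.1 f * walkExp d p.2 g := by
  rw [walkExp_congr (g := fun l => ∑ p ∈ Finset.HasAntidiagonal.antidiagonal N,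
    f (l.take p.1) * g (l.drop p.1)) (fun l hl => by rw [cutSum, hl]), walkExp_sum]
  refine Finset.sum_congr rfl fun p hp => ?_
  rw [Finset.HasAntidiagonal.mem_antidiagonal] at hp
  rw [← hp, walkExp_add, ← walkExp_mul]
  refine walkExp_congr fun u hu => walkExp_congr fun v _ => ?_
  rw [List.take_left' hu, List.drop_left' hu]

end Expectation

/-! ### Partition functions of paths and bridges -/

section Partition

variable {d : ℕ} [NeZero d] {φ : ℝ → ℝ} {β : ℝ}

/-- `E_0[k(S₁(N)) e^{-Φ_β(N)}; S[N] is a bridge]`. -/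
noncomputable def bridgeSum (d : ℕ) [NeZero d] (φ : ℝ → ℝ) (β : ℝ) (k : ℤ → ℝ) (N : ℕ) : ℝ :=
  walkExp d N (bridgeWt φ β k)

/-- `E_0[k(S₁(N)) e^{-Φ_β(N)}]`. -/
noncomputable def pathSum (d : ℕ) [NeZero d] (φ : ℝ → ℝ) (β : ℝ) (k : ℤ → ℝ) (N : ℕ) : ℝ :=
  walkExp d N fun l => k (height l) * Real.exp (-pot φ β l)

/-- `P_0[S₁(N) = 0]`. -/
noncomputable def retSum (d : ℕ) [NeZero d] (N : ℕ) : ℝ := walkExp d N retInd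

lemma retSum_nonneg (N : ℕ) : 0 ≤ retSum d N := walkExp_nonneg retInd_nonneg

lemma retSum_le_one (N : ℕ) : retSum d N ≤ 1 := by
  rw [← walkExp_const (d := d) N 1]
  exact walkExp_mono fun l _ => by unfold retInd; split_ifs <;> norm_num

lemma bridgeSum_nonneg {k : ℤ → ℝ} (hk : ∀ x, 0 ≤ k x) (N : ℕ) : 0 ≤ bridgeSum d φ β k N :=
  walkExp_nonneg (bridgeWt_nonneg hk)

lemma bridgeWt_le_weight {k : ℤ → ℝ} (hk : ∀ x, 0 ≤ k x) (l : List (Step d)) :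
    bridgeWt φ β k l ≤ k (height l) * Real.exp (-pot φ β l) := by
  by_cases h : BridgeList l
  · rw [bridgeWt_of_bridge _ h]
  · rw [bridgeWt_of_not_bridge _ h]; exact mul_nonneg (hk _) (Real.exp_pos _).le

lemma bridgeSum_le_pathSum {k : ℤ → ℝ} (hk : ∀ x, 0 ≤ k x) (N : ℕ) :
    bridgeSum d φ β k N ≤ pathSum d φ β k N :=
  walkExp_mono fun l _ => bridgeWt_le_weight hk l

lemma bridgeSum_le_of_bridge {β' : ℝ} {k k' : ℤ → ℝ} {c : ℝ} {N : ℕ}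
    (h : ∀ l : List (Step d), l.length = N → BridgeList l →
      c * (k (height l) * Real.exp (-pot φ β l)) ≤ k' (height l) * Real.exp (-pot φ β' l)) :
    c * bridgeSum d φ β k N ≤ bridgeSum d φ β' k' N := by
  rw [bridgeSum, ← walkExp_const_mul]
  refine walkExp_mono fun l hl => ?_
  by_cases hb : BridgeList l
  · rw [bridgeWt_of_bridge _ hb, bridgeWt_of_bridge _ hb]; exact h l hl hb
  · rw [bridgeWt_of_not_bridge _ hb, bridgeWt_of_not_bridge _ hb, mul_zero]

lemma height_le_length (l : List (Step d)) : height l ≤ l.length := by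
  have : ∀ n, height (l.take n) ≤ n := by
    intro n
    induction n with
    | zero => simp
    | succ n ih =>
      have := (abs_le.1 (abs_height_take_succ_sub_le l n)).2
      push_cast
      linarith
  simpa using this l.length

lemma bridgeSum_mul_le (hφ : IsPotential φ) (hβ : 0 ≤ β) {k₁ k₂ k₃ : ℤ → ℝ}
    (hk₃ : ∀ x, 0 ≤ k₃ x) (hk : ∀ x y, k₁ x * k₂ y ≤ k₃ (x + y)) (N M : ℕ) :
    bridgeSum d φ β k₁ N * bridgeSum d φ β k₂ M ≤ bridgeSum d φ β k₃ (N + M) := by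
  simp only [bridgeSum]
  rw [← walkExp_mul, walkExp_add]
  exact walkExp_mono fun u _ => walkExp_mono fun v _ => bridgeWt_mul_le hφ hβ hk₃ hk u v

lemma pathSum_le (hφ : IsPotential φ) (hβ : 0 ≤ β) {k : ℤ → ℝ} (hk : ∀ x, 0 ≤ k x)
    (hk0 : ∀ x < 0, k x = 0) (N : ℕ) :
    pathSum d φ β k N ≤ ∑ p ∈ Finset.HasAntidiagonal.antidiagonal N,
      retSum d p.1 * ∑ q ∈ Finset.HasAntidiagonal.antidiagonal p.2,
        bridgeSum d φ β k q.1 * retSum d q.2 := by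
  simp only [retSum, bridgeSum]
  simp only [← walkExp_cutSum]
  refine walkExp_mono fun l _ => ?_
  rcases lt_or_ge (height l) 0 with h | h
  · rw [hk0 _ h, zero_mul]
    exact cutSum_nonneg retInd_nonneg (cutSum_nonneg (bridgeWt_nonneg hk) retInd_nonneg) _
  · exact weight_le_cutSum hφ hβ hk h

lemma bridgeSum_add_le (hφ : IsPotential φ) (hβ : 0 ≤ β) {k k₁ k₂ : ℤ → ℝ}
    (hk₁ : ∀ x, 0 ≤ k₁ x) (hk₂ : ∀ x, 0 ≤ k₂ x) (hk : ∀ x y, k (x + y) ≤ k₁ x * k₂ y)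
    (N M : ℕ) :
    bridgeSum d φ β k (N + M) ≤
      (∑ p ∈ Finset.HasAntidiagonal.antidiagonal N, bridgeSum d φ β k₁ p.1 * retSum d p.2) *
      ∑ p ∈ Finset.HasAntidiagonal.antidiagonal M, retSum d p.1 * bridgeSum d φ β k₂ p.2 := by
  simp only [retSum, bridgeSum]
  rw [← walkExp_cutSum, ← walkExp_cutSum, ← walkExp_mul, walkExp_add]
  exact walkExp_mono fun u _ => walkExp_mono fun v _ => bridgeWt_append_le hφ hβ hk₁ hk₂ hk u v

lemma height_replicate (N : ℕ) :
    height (List.replicate N ((0, true) : Step d)) = N := by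
  simp [height, endpoint, Step.vec]

/-- The path that always steps in the direction of the first axis is a bridge. -/
lemma bridgeList_replicate (N : ℕ) : BridgeList (List.replicate N ((0, true) : Step d)) := by
  intro n h1 hn
  rw [List.length_replicate] at hn
  rw [List.take_replicate, height_replicate, height_replicate, min_eq_left hn]
  omega

lemma bridgeSum_pos {k : ℤ → ℝ} (hk : ∀ x, 0 ≤ k x) {N : ℕ} (hN : 0 < k N) :
    0 < bridgeSum d φ β k N := by
  have hd : (0 : ℝ) < d := Nat.cast_pos.2 (NeZero.pos d)
  refine div_pos (Finset.sum_pos' (fun _ _ => bridgeWt_nonneg hk _)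
    ⟨fun _ => (0, true), Finset.mem_univ _, ?_⟩) (by positivity)
  rw [List.ofFn_const, bridgeWt_of_bridge _ (bridgeList_replicate N), height_replicate]
  exact mul_pos hN (Real.exp_pos _)

/-- The weight `e^{h S₁(N)}` of the drift `h`. -/
noncomputable def tilt (h : ℝ) (x : ℤ) : ℝ := Real.exp (h * x)

lemma tilt_pos (h : ℝ) (x : ℤ) : 0 < tilt h x := Real.exp_pos _

lemma tilt_nonneg (h : ℝ) (x : ℤ) : 0 ≤ tilt h x := (tilt_pos h x).le

lemma tilt_add (h : ℝ) (x y : ℤ) : tilt h (x + y) = tilt h x * tilt h y := by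
  rw [tilt, tilt, tilt, ← Real.exp_add]; push_cast; ring_nf

/-- The moment generating function `E_0[e^{h S₁(1)}]` of one step. -/
noncomputable def stepMgf (d : ℕ) [NeZero d] (h : ℝ) : ℝ :=
  walkExp d 1 fun l => tilt h (height l)

lemma walkExp_tilt (h : ℝ) (N : ℕ) :
    walkExp d N (fun l => tilt h (height l)) = stepMgf d h ^ N := by
  induction N with
  | zero => simp [walkExp_zero, tilt]
  | succ N ih =>
    rw [walkExp_add, pow_succ, ← ih, stepMgf, ← walkExp_mul]
    simp only [height_append, tilt_add]

lemma stepMgf_eq (h : ℝ) : stepMgf d h = (d - 1 + Real.cosh h) / d := by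
  have hd : (d : ℝ) ≠ 0 := Nat.cast_ne_zero.2 (NeZero.ne d)
  have key : ∀ i : Fin d, tilt h (height [((i, true) : Step d)]) +
      tilt h (height [((i, false) : Step d)]) = 2 + if i = 0 then 2 * Real.cosh h - 2 else 0 := by
    intro i
    by_cases hi : i = 0
    · subst hi
      simp [height, endpoint, Step.vec, tilt, Real.cosh_eq]
      ring
    · simp [height, endpoint, Step.vec, tilt, hi]
      norm_num
  have e : ∑ s : Fin 1 → Step d, tilt h (height (List.ofFn s)) =
      ∑ i : Fin d, (tilt h (height [((i, true) : Step d)]) +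
        tilt h (height [((i, false) : Step d)])) := by
    rw [← (Equiv.funUnique (Fin 1) (Step d)).symm.sum_comp, Fintype.sum_prod_type]
    simp
  rw [stepMgf, walkExp, expect₀, e, Finset.sum_congr rfl fun i _ => key i]
  simp only [Finset.sum_add_distrib, Finset.sum_const, Finset.card_univ, Fintype.card_fin,
    Finset.sum_ite_eq', Finset.mem_univ, if_true, nsmul_eq_mul]
  field_simp
  ring

lemma one_lt_stepMgf {h : ℝ} (hh : 0 < h) : 1 < stepMgf d h := by
  have hd : (0 : ℝ) < d := Nat.cast_pos.2 (NeZero.pos d)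
  rw [stepMgf_eq, one_lt_div hd]
  have := Real.one_lt_cosh.2 hh.ne'
  linarith

lemma stepMgf_zero : stepMgf d 0 = 1 := by
  have hd : (d : ℝ) ≠ 0 := Nat.cast_ne_zero.2 (NeZero.ne d)
  rw [stepMgf_eq]; simp [hd]

lemma one_le_stepMgf {h : ℝ} (hh : 0 ≤ h) : 1 ≤ stepMgf d h := by
  rcases hh.eq_or_lt with rfl | h'
  · rw [stepMgf_zero]
  · exact (one_lt_stepMgf h').le

lemma continuous_stepMgf : Continuous (stepMgf d) := by
  have : stepMgf d = fun h => (d - 1 + Real.cosh h) / d := funext stepMgf_eq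
  rw [this]
  fun_prop

lemma expect_eq (h : ℝ) (N : ℕ) (f : (Fin N → Step d) → ℝ) (g : List (Step d) → ℝ)
    (hfg : ∀ s, f s = g (List.ofFn s)) :
    expect d h N f = walkExp d N (fun l => tilt h (height l) * g l) / stepMgf d h ^ N := by
  rw [← walkExp_tilt]
  simp only [expect, walkExp, pos₁_self, tilt, hfg]

lemma G_eq (hφ : IsPotential φ) (h β : ℝ) (N : ℕ) :
    G d φ h β N = pathSum d φ β (tilt h) N / stepMgf d h ^ N :=
  expect_eq h N _ (fun l => Real.exp (-pot φ β l)) fun s => by rw [pathPotential_eq hφ]; rfl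

lemma B_eq (hφ : IsPotential φ) (h β : ℝ) (N : ℕ) :
    B d φ h β N = bridgeSum d φ β (tilt h) N / stepMgf d h ^ N := by
  rw [B, expect_eq h N _ ({l | BridgeList l}.indicator fun l => Real.exp (-pot φ β l))]
  · congr 2
    ext l
    exact (indicator_mul_right {l | BridgeList l} (fun l => tilt h (height l))
      (fun l => Real.exp (-pot φ β l))).symm
  · intro s
    classical
    simp only [indicator_apply, mem_ofPred_eq, isBridge_iff, pathPotential_eq hφ, pot]

lemma returnProb_eq (h : ℝ) (n : ℕ) :
    returnProb d h n = retSum d n / stepMgf d h ^ n := by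
  rw [returnProb, expect_eq h n _ retInd]
  · congr 2
    ext l
    unfold retInd
    split_ifs with h0 <;> simp [h0, tilt]
  · intro s
    simp only [indicator_apply, mem_ofPred_eq, pos₁_self, retInd]

/-- The indicator function of the level `L`. -/
noncomputable def level (L : ℕ) (x : ℤ) : ℝ := if x = L then 1 else 0

lemma level_nonneg (L : ℕ) (x : ℤ) : 0 ≤ level L x := by unfold level; split_ifs <;> simp

lemma Gbar_eq (hφ : IsPotential φ) (h β : ℝ) (L : ℕ) :
    Gbar d φ h β L = Real.exp (h * L) *
      ∑' N : ℕ, pathSum d φ β (level L) (N + 1) / stepMgf d h ^ (N + 1) := by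
  rw [Gbar, ← tsum_mul_left]
  refine tsum_congr fun N => ?_
  rw [expect_eq h _ _ ({l | height l = L}.indicator fun l => Real.exp (-pot φ β l)),
    ← mul_div_assoc, pathSum, ← walkExp_const_mul]
  · congr 2
    ext l
    simp only [indicator_apply, mem_ofPred_eq, level]
    split_ifs with h0 <;> simp [tilt, h0]
  · intro s
    simp only [indicator_apply, mem_ofPred_eq, pos₁_self, pathPotential_eq hφ, pot]

end Partition

/-! ### Generating functions at fixed height -/

section GeneratingFunction

variable {d : ℕ} [NeZero d] {φ : ℝ → ℝ} {lam β : ℝ}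

lemma pathSum_nonneg {k : ℤ → ℝ} (hk : ∀ x, 0 ≤ k x) (N : ℕ) : 0 ≤ pathSum d φ β k N :=
  walkExp_nonneg fun _ => mul_nonneg (hk _) (Real.exp_pos _).le

lemma pathSum_le_const (hφ : IsPotential φ) (hβ : 0 ≤ β) {k : ℤ → ℝ} {c : ℝ}
    (hk : ∀ x, 0 ≤ k x) (hc : ∀ x, k x ≤ c) (N : ℕ) : pathSum d φ β k N ≤ c := by
  rw [← walkExp_const (d := d) N c]
  exact walkExp_mono fun l _ =>
    (mul_le_of_le_one_right (hk _) (exp_neg_pot_le_one hφ hβ l)).trans (hc _)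

lemma level_le_one (L : ℕ) (x : ℤ) : level L x ≤ 1 := by unfold level; split_ifs <;> simp

/-- The cut of a bridge into bridges of given heights is unique: its time is the last visit to the
level of the cut. -/
lemma cutSum_level_le (hφ : IsPotential φ) (hβ : 0 ≤ β) (L L' : ℕ) (l : List (Step d)) :
    cutSum (bridgeWt φ β (level L)) (bridgeWt φ β (level L')) l ≤
      bridgeWt φ β (level (L + L')) l := by
  have hle : ∀ u v : List (Step d), bridgeWt φ β (level L) u * bridgeWt φ β (level L') v ≤
      bridgeWt φ β (level (L + L')) (u ++ v) := by
    refine bridgeWt_mul_le hφ hβ (level_nonneg _) fun x y => ?_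
    unfold level
    split_ifs with h1 h2 h3 h4 h5 <;> try simp
    · exact absurd (by rw [h1, h2]; push_cast; ring) h3
  have hne : ∀ (K : ℕ) (u : List (Step d)), bridgeWt φ β (level K) u ≠ 0 →
      BridgeList u ∧ height u = K := by
    intro K u hu
    have hb : BridgeList u := by
      by_contra h; exact hu (bridgeWt_of_not_bridge _ h)
    refine ⟨hb, ?_⟩
    by_contra h
    rw [bridgeWt_of_bridge _ hb, level, if_neg h, zero_mul] at hu
    exact hu rfl
  by_cases hall : ∀ p ∈ Finset.HasAntidiagonal.antidiagonal l.length,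
      bridgeWt φ β (level L) (l.take p.1) * bridgeWt φ β (level L') (l.drop p.1) = 0
  · rw [cutSum, Finset.sum_eq_zero hall]
    exact bridgeWt_nonneg (level_nonneg _) _
  push Not at hall
  obtain ⟨p, hp, hp0⟩ := hall
  rw [cutSum, Finset.sum_eq_single p]
  · have := hle (l.take p.1) (l.drop p.1)
    rwa [List.take_append_drop] at this
  · intro q hq hqp
    by_contra hq0
    rw [Finset.HasAntidiagonal.mem_antidiagonal] at hp hq
    have aux : ∀ a b : ℕ, a < b → b ≤ l.length → height (l.take a) = L → height (l.take b) = L →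
        BridgeList (l.drop a) → False := by
      intro a b hab hb h1 h2 hbr
      have := (hbr (b - a) (by omega) (by rw [List.length_drop]; omega)).1
      rw [height_take_drop, Nat.add_sub_cancel' hab.le] at this
      omega
    have p1 := hne L _ (left_ne_zero_of_mul hp0)
    have p2 := hne L' _ (right_ne_zero_of_mul hp0)
    have q1 := hne L _ (left_ne_zero_of_mul hq0)
    have q2 := hne L' _ (right_ne_zero_of_mul hq0)
    rcases lt_trichotomy p.1 q.1 with h | h | h
    · exact aux _ _ h (by omega) p1.2 q1.2 p2.1
    · exact hqp (Prod.ext h.symm (by omega))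
    · exact aux _ _ h (by omega) q1.2 p1.2 q2.1
  · exact fun h => absurd hp h

lemma sum_bridgeSum_level_le (hφ : IsPotential φ) (hβ : 0 ≤ β) (L L' N : ℕ) :
    ∑ p ∈ Finset.HasAntidiagonal.antidiagonal N,
      bridgeSum d φ β (level L) p.1 * bridgeSum d φ β (level L') p.2 ≤
      bridgeSum d φ β (level (L + L')) N := by
  simp only [bridgeSum, ← walkExp_cutSum]
  exact walkExp_mono fun l _ => cutSum_level_le hφ hβ L L' l

/-- The generating function `∑_N e^{-λ N} E_0[e^{-Φ_β(N)}; S[N] is a bridge, S₁(N) = L]`. -/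
noncomputable def bridgeGF (d : ℕ) [NeZero d] (φ : ℝ → ℝ) (lam β : ℝ) (L : ℕ) : ℝ :=
  ∑' N : ℕ, Real.exp (-lam) ^ N * bridgeSum d φ β (level L) N

/-- The generating function `∑_N e^{-λ N} E_0[e^{-Φ_β(N)}; S₁(N) = L]`. -/
noncomputable def pathGF (d : ℕ) [NeZero d] (φ : ℝ → ℝ) (lam β : ℝ) (L : ℕ) : ℝ :=
  ∑' N : ℕ, Real.exp (-lam) ^ N * pathSum d φ β (level L) N

/-- The geometric series `∑_N e^{-λ N}`. -/
noncomputable def geo (lam : ℝ) : ℝ := (1 - Real.exp (-lam))⁻¹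

lemma exp_neg_lt_one (hl : 0 < lam) : Real.exp (-lam) < 1 := by
  rw [Real.exp_lt_one_iff]; linarith

lemma hasSum_geo (hl : 0 < lam) : HasSum (fun N : ℕ => Real.exp (-lam) ^ N) (geo lam) :=
  hasSum_geometric_of_lt_one (Real.exp_pos _).le (exp_neg_lt_one hl)

lemma one_le_geo (hl : 0 < lam) : 1 ≤ geo lam := by
  have := exp_neg_lt_one hl
  have := Real.exp_pos (-lam)
  exact (one_le_inv₀ (by linarith)).2 (by linarith)

lemma summable_pow_mul (hl : 0 < lam) {f : ℕ → ℝ} {c : ℝ} (hf : ∀ N, 0 ≤ f N)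
    (hc : ∀ N, f N ≤ c) : Summable fun N => Real.exp (-lam) ^ N * f N :=
  Summable.of_nonneg_of_le (fun N => mul_nonneg (by positivity) (hf N))
    (fun N => mul_le_mul_of_nonneg_left (hc N) (by positivity))
    ((hasSum_geo hl).summable.mul_right c)

lemma tsum_pow_mul_le (hl : 0 < lam) {f : ℕ → ℝ} {c : ℝ} (hf : ∀ N, 0 ≤ f N)
    (hc : ∀ N, f N ≤ c) : ∑' N, Real.exp (-lam) ^ N * f N ≤ geo lam * c := by
  rw [← (hasSum_geo hl).tsum_eq, ← tsum_mul_right]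
  exact (summable_pow_mul hl hf hc).tsum_le_tsum
    (fun N => mul_le_mul_of_nonneg_left (hc N) (by positivity))
    ((hasSum_geo hl).summable.mul_right c)

lemma bridgeSum_level_le_one (hφ : IsPotential φ) (hβ : 0 ≤ β) (L N : ℕ) :
    bridgeSum d φ β (level L) N ≤ 1 :=
  (bridgeSum_le_pathSum (level_nonneg L) N).trans
    (pathSum_le_const hφ hβ (level_nonneg L) (level_le_one L) N)

lemma summable_bridgeGF (hφ : IsPotential φ) (hl : 0 < lam) (hβ : 0 ≤ β) (L : ℕ) :
    Summable fun N => Real.exp (-lam) ^ N * bridgeSum d φ β (level L) N :=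
  summable_pow_mul hl (bridgeSum_nonneg (level_nonneg L)) (bridgeSum_level_le_one hφ hβ L)

lemma summable_pathGF (hφ : IsPotential φ) (hl : 0 < lam) (hβ : 0 ≤ β) (L : ℕ) :
    Summable fun N => Real.exp (-lam) ^ N * pathSum d φ β (level L) N :=
  summable_pow_mul hl (pathSum_nonneg (level_nonneg L))
    (pathSum_le_const hφ hβ (level_nonneg L) (level_le_one L))

lemma bridgeGF_pos (hφ : IsPotential φ) (hl : 0 < lam) (hβ : 0 ≤ β) (L : ℕ) :
    0 < bridgeGF d φ lam β L :=
  (summable_bridgeGF hφ hl hβ L).tsum_pos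
    (fun N => mul_nonneg (by positivity) (bridgeSum_nonneg (level_nonneg L) N)) L
    (mul_pos (by positivity) (bridgeSum_pos (level_nonneg L) (by simp [level])))

lemma bridgeGF_le (hφ : IsPotential φ) (hl : 0 < lam) (hβ : 0 ≤ β) (L : ℕ) :
    bridgeGF d φ lam β L ≤ geo lam * Real.exp (-(L * φ β)) := by
  refine tsum_pow_mul_le hl (bridgeSum_nonneg (level_nonneg L)) fun N => ?_
  rw [← walkExp_const (d := d) N (Real.exp _)]
  refine walkExp_mono fun l _ => (bridgeWt_le_weight (level_nonneg L) l).trans ?_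
  unfold level
  split_ifs with h
  · rw [one_mul]
    refine Real.exp_le_exp.2 (neg_le_neg ?_)
    have := height_mul_le_pot hφ hβ l
    rwa [h, Int.cast_natCast] at this
  · rw [zero_mul]; exact (Real.exp_pos _).le

lemma bridgeGF_le_pathGF (hφ : IsPotential φ) (hl : 0 < lam) (hβ : 0 ≤ β) (L : ℕ) :
    bridgeGF d φ lam β L ≤ pathGF d φ lam β L :=
  (summable_bridgeGF hφ hl hβ L).tsum_le_tsum
    (fun N => mul_le_mul_of_nonneg_left (bridgeSum_le_pathSum (level_nonneg L) N) (by positivity))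
    (summable_pathGF hφ hl hβ L)

lemma pow_mul_sum_antidiagonal (x : ℝ) (f g : ℕ → ℝ) (N : ℕ) :
    x ^ N * ∑ p ∈ Finset.HasAntidiagonal.antidiagonal N, f p.1 * g p.2 =
      ∑ p ∈ Finset.HasAntidiagonal.antidiagonal N, (x ^ p.1 * f p.1) * (x ^ p.2 * g p.2) := by
  rw [Finset.mul_sum]
  refine Finset.sum_congr rfl fun p hp => ?_
  rw [Finset.HasAntidiagonal.mem_antidiagonal] at hp
  rw [← hp, pow_add]
  ring

/-- The generating function of a convolution is the product of the generating functions. -/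
lemma hasSum_convolution {x : ℝ} {f g : ℕ → ℝ}
    (hf : Summable fun n => x ^ n * f n)
    (hg : Summable fun n => x ^ n * g n) :
    HasSum (fun N => x ^ N * ∑ p ∈ Finset.HasAntidiagonal.antidiagonal N, f p.1 * g p.2)
      ((∑' n, x ^ n * f n) * ∑' n, x ^ n * g n) := by
  have h1 := summable_norm_sum_mul_antidiagonal_of_summable_norm hf.norm hg.norm
  rw [tsum_mul_tsum_eq_tsum_sum_antidiagonal_of_summable_norm hf.norm hg.norm]
  simp only [pow_mul_sum_antidiagonal]
  exact h1.of_norm.hasSum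

lemma bridgeGF_mul_le (hφ : IsPotential φ) (hl : 0 < lam) (hβ : 0 ≤ β) (L L' : ℕ) :
    bridgeGF d φ lam β L * bridgeGF d φ lam β L' ≤ bridgeGF d φ lam β (L + L') := by
  have key := hasSum_convolution (x := Real.exp (-lam))
    (f := bridgeSum d φ β (level L)) (g := bridgeSum d φ β (level L'))
    (summable_bridgeGF hφ hl hβ L) (summable_bridgeGF hφ hl hβ L')
  exact hasSum_le (fun N => mul_le_mul_of_nonneg_left (sum_bridgeSum_level_le hφ hβ L L' N)
    (pow_nonneg (Real.exp_pos (-lam)).le N)) key (summable_bridgeGF hφ hl hβ (L + L')).hasSum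

lemma pathGF_le (hφ : IsPotential φ) (hl : 0 < lam) (hβ : 0 ≤ β) (L : ℕ) :
    pathGF d φ lam β L ≤ geo lam ^ 2 * bridgeGF d φ lam β L := by
  set R := ∑' N, Real.exp (-lam) ^ N * retSum d N with hR
  have hRle : R ≤ geo lam := by
    simpa using tsum_pow_mul_le hl retSum_nonneg (retSum_le_one (d := d))
  have hR0 : 0 ≤ R := tsum_nonneg fun N => mul_nonneg (by positivity) (retSum_nonneg N)
  have hrs := summable_pow_mul hl (retSum_nonneg (d := d)) retSum_le_one
  have k1 := hasSum_convolution (x := Real.exp (-lam))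
    (f := bridgeSum d φ β (level L)) (g := retSum d)
    (summable_bridgeGF hφ hl hβ L) hrs
  have k2 := hasSum_convolution (x := Real.exp (-lam))
    (f := retSum d) (g := fun n => ∑ q ∈ Finset.HasAntidiagonal.antidiagonal n,
      bridgeSum d φ β (level L) q.1 * retSum d q.2)
    hrs k1.summable
  rw [k1.tsum_eq] at k2
  have hmain : pathGF d φ lam β L ≤ R * (bridgeGF d φ lam β L * R) :=
    hasSum_le (fun N => mul_le_mul_of_nonneg_left (pathSum_le hφ hβ (level_nonneg L)
      (fun x hx => if_neg (by omega)) N) (pow_nonneg (Real.exp_pos (-lam)).le N))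
      (summable_pathGF hφ hl hβ L).hasSum k2
  refine hmain.trans ?_
  have hb := (bridgeGF_pos (d := d) hφ hl hβ L).le
  calc R * (bridgeGF d φ lam β L * R) = R ^ 2 * bridgeGF d φ lam β L := by ring
    _ ≤ _ := mul_le_mul_of_nonneg_right (pow_le_pow_left₀ hR0 hRle 2) hb

/-- Logarithmic convexity of the generating function in `(λ, β)`, from the convexity of `exp` and
the concavity of `φ`. -/
lemma log_bridgeGF_le (hφ : IsPotential φ) {lam' β' s t : ℝ} (hl : 0 < lam) (hl' : 0 < lam')
    (hβ : 0 ≤ β) (hβ' : 0 ≤ β') (hs : 0 ≤ s) (ht : 0 ≤ t) (hst : s + t = 1) (L : ℕ) :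
    Real.log (bridgeGF d φ (s * lam + t * lam') (s * β + t * β') L) ≤
      s * Real.log (bridgeGF d φ lam β L) + t * Real.log (bridgeGF d φ lam' β' L) := by
  set F := bridgeGF d φ lam β L with hF
  set F' := bridgeGF d φ lam' β' L with hF'
  have hFp : 0 < F := bridgeGF_pos hφ hl hβ L
  have hFp' : 0 < F' := bridgeGF_pos hφ hl' hβ' L
  have hlc : 0 < s * lam + t * lam' := by
    rcases hs.eq_or_lt with rfl | hs'
    · have : t = 1 := by linarith
      subst this; simpa using hl'
    · have : 0 ≤ t * lam' := by positivity
      have : 0 < s * lam := by positivity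
      linarith
  have hβc : 0 ≤ s * β + t * β' := by positivity
  set E := Real.exp (-(s * Real.log F + t * Real.log F')) with hE
  -- `e^{s a + t b} ≤ s e^a + t e^b`, where `a` and `b` are normalized by `log F` and `log F'`
  have hpt : ∀ N : ℕ, E * (Real.exp (-(s * lam + t * lam')) ^ N *
      bridgeSum d φ (s * β + t * β') (level L) N) ≤
      s / F * (Real.exp (-lam) ^ N * bridgeSum d φ β (level L) N) +
      t / F' * (Real.exp (-lam') ^ N * bridgeSum d φ β' (level L) N) := by
    intro N
    simp only [bridgeSum, ← walkExp_const_mul]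
    rw [← walkExp_add_fun]
    refine walkExp_mono fun l _ => ?_
    by_cases hb : BridgeList l
    swap
    · simp [bridgeWt_of_not_bridge _ hb]
    simp only [bridgeWt_of_bridge _ hb]
    have hcv := convexOn_exp.2 (x := -(lam * N) - pot φ β l - Real.log F)
      (y := -(lam' * N) - pot φ β' l - Real.log F') (mem_univ _) (mem_univ _) hs ht hst
    simp only [smul_eq_mul, Real.exp_sub, Real.exp_log hFp, Real.exp_log hFp'] at hcv
    have hpc : s * pot φ β l + t * pot φ β' l ≤ pot φ (s * β + t * β') l :=
      sitePot_concave hφ _ hs ht hst hβ hβ'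
    have h1 : E * (Real.exp (-(s * lam + t * lam')) ^ N *
        Real.exp (-pot φ (s * β + t * β') l)) ≤
        Real.exp (s * (-(lam * N) - pot φ β l - Real.log F) +
          t * (-(lam' * N) - pot φ β' l - Real.log F')) := by
      rw [hE, ← Real.exp_nat_mul, ← Real.exp_add, ← Real.exp_add]
      refine Real.exp_le_exp.2 ?_
      nlinarith
    have h2 := mul_le_mul_of_nonneg_left (h1.trans hcv) (level_nonneg L (height l))
    refine (le_of_eq ?_).trans (h2.trans (le_of_eq ?_))
    · ring
    · rw [← Real.exp_nat_mul, ← Real.exp_nat_mul, Real.exp_neg (pot φ β l),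
        Real.exp_neg (pot φ β' l)]
      have e1 : (N : ℝ) * -lam = -(lam * N) := by ring
      have e2 : (N : ℝ) * -lam' = -(lam' * N) := by ring
      rw [e1, e2]
      ring
  have hsum : E * bridgeGF d φ (s * lam + t * lam') (s * β + t * β') L ≤ 1 := by
    rw [bridgeGF, ← tsum_mul_left]
    have hs1 := (summable_bridgeGF (d := d) hφ hl hβ L).mul_left (s / F)
    have hs2 := (summable_bridgeGF (d := d) hφ hl' hβ' L).mul_left (t / F')
    refine (Summable.tsum_le_tsum hpt ((summable_bridgeGF hφ hlc hβc L).mul_left E)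
      (hs1.add hs2)).trans_eq ?_
    rw [hs1.tsum_add hs2, tsum_mul_left, tsum_mul_left]
    change s / F * F + t / F' * F' = 1
    rw [div_mul_cancel₀ _ hFp.ne', div_mul_cancel₀ _ hFp'.ne', hst]
  have := Real.log_le_log (mul_pos (Real.exp_pos _) (bridgeGF_pos hφ hlc hβc L)) hsum
  rw [Real.log_mul (Real.exp_pos _).ne' (bridgeGF_pos hφ hlc hβc L).ne', Real.log_exp,
    Real.log_one] at this
  linarith

end GeneratingFunction

/-! ### The point-to-hyperplane mass -/

section PlaneMass

variable {d : ℕ} [NeZero d] {φ : ℝ → ℝ} {lam β : ℝ}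

/-- The exponential decay rate in `L` of the generating function of bridges of height `L`,
a limit that exists for `λ > 0` and `β ≥ 0` by Fekete's lemma. -/
noncomputable def planeMass (d : ℕ) [NeZero d] (φ : ℝ → ℝ) (lam β : ℝ) : ℝ :=
  limUnder atTop fun L : ℕ => -Real.log (bridgeGF d φ lam β L) / L

lemma subadditive_log_bridgeGF (hφ : IsPotential φ) (hl : 0 < lam) (hβ : 0 ≤ β) :
    Subadditive fun L : ℕ => -Real.log (bridgeGF d φ lam β L) := by
  intro L L'
  have h1 := bridgeGF_pos (d := d) hφ hl hβ L
  have h2 := bridgeGF_pos (d := d) hφ hl hβ L'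
  have := Real.log_le_log (mul_pos h1 h2) (bridgeGF_mul_le hφ hl hβ L L')
  rw [Real.log_mul h1.ne' h2.ne'] at this
  linarith

lemma le_neg_log_bridgeGF (hφ : IsPotential φ) (hl : 0 < lam) (hβ : 0 ≤ β) {c : ℝ} {L : ℕ}
    (h : bridgeGF d φ lam β L ≤ geo lam * Real.exp (-(L * c))) :
    L * c - Real.log (geo lam) ≤ -Real.log (bridgeGF d φ lam β L) := by
  have hg : 0 < geo lam := one_pos.trans_le (one_le_geo hl)
  have := Real.log_le_log (bridgeGF_pos hφ hl hβ L) h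
  rw [Real.log_mul hg.ne' (Real.exp_pos _).ne', Real.log_exp] at this
  linarith

lemma bddBelow_log_bridgeGF (hφ : IsPotential φ) (hl : 0 < lam) (hβ : 0 ≤ β) :
    BddBelow (range fun L : ℕ => -Real.log (bridgeGF d φ lam β L) / L) := by
  have hg := Real.log_nonneg (one_le_geo hl)
  refine ⟨-Real.log (geo lam), ?_⟩
  rintro _ ⟨L, rfl⟩
  rcases Nat.eq_zero_or_pos L with rfl | hL
  · simpa using hg
  have hL1 : (1 : ℝ) ≤ L := by exact_mod_cast hL
  have h1 := le_neg_log_bridgeGF hφ hl hβ (bridgeGF_le (d := d) hφ hl hβ L)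
  have h2 := hφ.nonneg β hβ
  change _ ≤ _ / _
  rw [le_div_iff₀ (by linarith)]
  have : 0 ≤ L * φ β := by positivity
  nlinarith

lemma tendsto_planeMass (hφ : IsPotential φ) (hl : 0 < lam) (hβ : 0 ≤ β) :
    Tendsto (fun L : ℕ => -Real.log (bridgeGF d φ lam β L) / L) atTop
      (𝓝 (planeMass d φ lam β)) :=
  tendsto_nhds_limUnder
    ⟨_, (subadditive_log_bridgeGF hφ hl hβ).tendsto_lim (bddBelow_log_bridgeGF hφ hl hβ)⟩

lemma tendsto_const_div_nat (c : ℝ) : Tendsto (fun L : ℕ => c / (L : ℝ)) atTop (𝓝 0) :=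
  tendsto_const_nhds.div_atTop tendsto_natCast_atTop_atTop

lemma pathGF_pos (hφ : IsPotential φ) (hl : 0 < lam) (hβ : 0 ≤ β) (L : ℕ) :
    0 < pathGF d φ lam β L :=
  (bridgeGF_pos hφ hl hβ L).trans_le (bridgeGF_le_pathGF hφ hl hβ L)

/-- For `λ > 0` paths and bridges have the same mass. -/
lemma tendsto_log_pathGF (hφ : IsPotential φ) (hl : 0 < lam) (hβ : 0 ≤ β) :
    Tendsto (fun L : ℕ => -Real.log (pathGF d φ lam β L) / L) atTop
      (𝓝 (planeMass d φ lam β)) := by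
  have hg : 0 < geo lam ^ 2 := pow_pos (one_pos.trans_le (one_le_geo hl)) 2
  have h1 := (tendsto_planeMass (d := d) hφ hl hβ).sub
    (tendsto_const_div_nat (Real.log (geo lam ^ 2)))
  rw [sub_zero] at h1
  refine tendsto_of_tendsto_of_tendsto_of_le_of_le h1 (tendsto_planeMass hφ hl hβ)
    (fun L => ?_) (fun L => ?_)
  · have hb := bridgeGF_pos (d := d) hφ hl hβ L
    have := Real.log_le_log (pathGF_pos hφ hl hβ L) (pathGF_le (d := d) hφ hl hβ L)
    rw [Real.log_mul hg.ne' hb.ne'] at this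
    change _ / _ - _ / _ ≤ _ / _
    rw [← sub_div]
    exact div_le_div_of_nonneg_right (by linarith) (Nat.cast_nonneg L)
  · refine div_le_div_of_nonneg_right (neg_le_neg ?_) (Nat.cast_nonneg L)
    exact Real.log_le_log (bridgeGF_pos hφ hl hβ L) (bridgeGF_le_pathGF hφ hl hβ L)

lemma planeMass_le_of_bridgeGF_le (hφ : IsPotential φ) {lam' β' : ℝ} (hl : 0 < lam)
    (hl' : 0 < lam') (hβ : 0 ≤ β) (hβ' : 0 ≤ β')
    (h : ∀ L, bridgeGF d φ lam' β' L ≤ bridgeGF d φ lam β L) :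
    planeMass d φ lam β ≤ planeMass d φ lam' β' :=
  le_of_tendsto_of_tendsto' (tendsto_planeMass hφ hl hβ) (tendsto_planeMass hφ hl' hβ') fun L =>
    div_le_div_of_nonneg_right
      (neg_le_neg (Real.log_le_log (bridgeGF_pos hφ hl' hβ' L) (h L))) (Nat.cast_nonneg L)

lemma bridgeSum_anti (hφ : IsPotential φ) {β' : ℝ} (hβ : 0 ≤ β) (h : β ≤ β') {k : ℤ → ℝ}
    (hk : ∀ x, 0 ≤ k x) (N : ℕ) : bridgeSum d φ β' k N ≤ bridgeSum d φ β k N := by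
  rw [← one_mul (bridgeSum d φ β' k N)]
  refine bridgeSum_le_of_bridge fun l _ _ => ?_
  rw [one_mul]
  exact mul_le_mul_of_nonneg_left
    (Real.exp_le_exp.2 (neg_le_neg (sitePot_mono hφ hβ h _))) (hk _)

lemma planeMass_mono_left (hφ : IsPotential φ) {lam' : ℝ} (hl : 0 < lam) (h : lam ≤ lam')
    (hβ : 0 ≤ β) : planeMass d φ lam β ≤ planeMass d φ lam' β :=
  planeMass_le_of_bridgeGF_le hφ hl (hl.trans_le h) hβ hβ fun L =>
    Summable.tsum_le_tsum (fun N => mul_le_mul_of_nonneg_right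
      (pow_le_pow_left₀ (Real.exp_pos _).le (Real.exp_le_exp.2 (neg_le_neg h)) N)
      (bridgeSum_nonneg (level_nonneg L) N))
      (summable_bridgeGF hφ (hl.trans_le h) hβ L) (summable_bridgeGF hφ hl hβ L)

/-- As the potential of a path of length `N` is at most `N φ(β)`, it can be traded for an increase
of `λ`. -/
lemma planeMass_le_zero_right (hφ : IsPotential φ) (hl : 0 < lam) (hβ : 0 ≤ β) :
    planeMass d φ lam β ≤ planeMass d φ (lam + φ β) 0 := by
  have hp := hφ.nonneg β hβ
  refine planeMass_le_of_bridgeGF_le hφ hl (by linarith) hβ le_rfl fun L =>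
    Summable.tsum_le_tsum (fun N => ?_)
      (summable_bridgeGF hφ (by linarith) le_rfl L) (summable_bridgeGF hφ hl hβ L)
  rw [neg_add, Real.exp_add, mul_pow, mul_assoc]
  refine mul_le_mul_of_nonneg_left (bridgeSum_le_of_bridge fun l hN _ => ?_) (by positivity)
  rw [mul_left_comm]
  refine mul_le_mul_of_nonneg_left ?_ (level_nonneg _ _)
  rw [← Real.exp_nat_mul, ← Real.exp_add, pot, sitePot_zero hφ]
  refine Real.exp_le_exp.2 ?_
  have := sitePot_le_length hφ hβ (visits l)
  rw [length_visits, hN] at this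
  rw [pot]
  linarith

lemma le_planeMass_of_bridgeGF_le (hφ : IsPotential φ) (hl : 0 < lam) (hβ : 0 ≤ β) {c : ℝ}
    (h : ∀ L : ℕ, bridgeGF d φ lam β L ≤ geo lam * Real.exp (-(L * c))) :
    c ≤ planeMass d φ lam β := by
  have h1 := (tendsto_const_nhds (x := c)).sub (tendsto_const_div_nat (Real.log (geo lam)))
  rw [sub_zero] at h1
  refine le_of_tendsto_of_tendsto h1 (tendsto_planeMass hφ hl hβ) ?_
  filter_upwards [eventually_ge_atTop 1] with L hL
  have hL0 : (0 : ℝ) < L := by exact_mod_cast hL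
  change _ - _ / _ ≤ _
  rw [le_div_iff₀ hL0, sub_mul, div_mul_cancel₀ _ hL0.ne', mul_comm]
  exact le_neg_log_bridgeGF hφ hl hβ (h L)

lemma le_planeMass (hφ : IsPotential φ) (hl : 0 < lam) (hβ : 0 ≤ β) :
    φ β ≤ planeMass d φ lam β :=
  le_planeMass_of_bridgeGF_le hφ hl hβ (bridgeGF_le hφ hl hβ)

lemma planeMass_concave (hφ : IsPotential φ) {lam' β' s t : ℝ} (hl : 0 < lam) (hl' : 0 < lam')
    (hβ : 0 ≤ β) (hβ' : 0 ≤ β') (hs : 0 ≤ s) (ht : 0 ≤ t) (hst : s + t = 1)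
    (hlc : 0 < s * lam + t * lam') :
    s * planeMass d φ lam β + t * planeMass d φ lam' β' ≤
      planeMass d φ (s * lam + t * lam') (s * β + t * β') := by
  refine le_of_tendsto_of_tendsto' (((tendsto_planeMass hφ hl hβ).const_mul s).add
    ((tendsto_planeMass hφ hl' hβ').const_mul t))
    (tendsto_planeMass hφ hlc (by positivity)) fun L => ?_
  rw [← mul_div_assoc, ← mul_div_assoc, ← add_div]
  refine div_le_div_of_nonneg_right ?_ (Nat.cast_nonneg L)
  have := log_bridgeGF_le (d := d) hφ hl hl' hβ hβ' hs ht hst L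
  linarith

lemma continuousOn_planeMass (hφ : IsPotential φ) (hβ : 0 ≤ β) :
    ContinuousOn (fun lam => planeMass d φ lam β) (Ioi 0) := by
  refine ConcaveOn.continuousOn isOpen_Ioi ⟨convex_Ioi 0, fun x hx y hy s t hs ht hst => ?_⟩
  have := planeMass_concave (d := d) hφ hx hy hβ hβ hs ht hst
    (by simpa using convex_Ioi (0 : ℝ) hx hy hs ht hst)
  rwa [← add_mul, hst, one_mul] at this

/-- Reaching the half-space above level `L` requires a visit to level `L`. -/
lemma le_cutSum_level (h : ℝ) (L : ℕ) (l : List (Step d)) :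
    (if (L : ℤ) ≤ height l then tilt h (height l) else 0) ≤
      cutSum (fun u => level L (height u) * tilt h (height u)) (fun v => tilt h (height v)) l := by
  have hf : ∀ u : List (Step d), 0 ≤ level L (height u) * tilt h (height u) := fun u =>
    mul_nonneg (level_nonneg _ _) (tilt_nonneg _ _)
  have hg : ∀ v : List (Step d), 0 ≤ tilt h (height v) := fun v => tilt_nonneg _ _
  split_ifs with hL
  · obtain ⟨k, -, hk, hkL⟩ := exists_height_take_eq l (n := 0) (m := l.length) (c := L)
      (Nat.zero_le _) (by simp) (by simpa using hL)
    refine le_trans (le_of_eq ?_) (le_cutSum hf hg hk)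
    rw [hkL, level, if_pos rfl, one_mul, ← hkL, ← tilt_add, ← height_append,
      List.take_append_drop]
  · exact cutSum_nonneg hf hg l

lemma stepMgf_pos {h : ℝ} (hh : 0 ≤ h) : 0 < stepMgf d h := one_pos.trans_le (one_le_stepMgf hh)

lemma log_stepMgf_pos {h : ℝ} (hh : 0 < h) : 0 < Real.log (stepMgf d h) :=
  Real.log_pos (one_lt_stepMgf hh)

lemma exp_neg_log_stepMgf {h : ℝ} (hh : 0 ≤ h) :
    Real.exp (-Real.log (stepMgf d h)) = (stepMgf d h)⁻¹ := by
  rw [Real.exp_neg, Real.exp_log (stepMgf_pos hh)]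

/-- The walk with drift `h > 0` visits every level `L ≥ 0` at least once on average. -/
lemma exp_neg_le_pathGF (hφ : IsPotential φ) {h : ℝ} (hh : 0 < h) (L : ℕ) :
    Real.exp (-(h * L)) ≤ pathGF d φ (Real.log (stepMgf d h)) 0 L := by
  set Z := stepMgf d h with hZ
  have hZ0 : 0 < Z := stepMgf_pos hh.le
  have hZ1 : 1 < Z := one_lt_stepMgf hh
  have hN : ∀ N : ℕ, 1 - Real.exp (h * L) * Z⁻¹ ^ N ≤
      Real.exp (h * L) * pathGF d φ (Real.log Z) 0 L := by
    intro N
    have e1 : Z ^ N ≤ walkExp d N (fun l => if (L : ℤ) ≤ height l then tilt h (height l) else 0) +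
        Real.exp (h * L) := by
      rw [hZ, ← walkExp_tilt, ← walkExp_const (d := d) N (Real.exp (h * L)), ← walkExp_add_fun]
      refine walkExp_mono fun l _ => ?_
      split_ifs with hL
      · exact le_add_of_nonneg_right (Real.exp_pos _).le
      · rw [zero_add, tilt]
        refine Real.exp_le_exp.2 (mul_le_mul_of_nonneg_left ?_ hh.le)
        have : height l ≤ L := by omega
        exact_mod_cast this
    have e2 := walkExp_mono (N := N) fun (l : List (Step d)) _ => le_cutSum_level h L l
    rw [walkExp_cutSum] at e2
    have e3 : ∀ p ∈ Finset.HasAntidiagonal.antidiagonal N,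
        walkExp d p.1 (fun u => level L (height u) * tilt h (height u)) *
          walkExp d p.2 (fun v => tilt h (height v)) =
        Z ^ N * Real.exp (h * L) * (Z⁻¹ ^ p.1 * pathSum d φ 0 (level L) p.1) := by
      intro p hp
      rw [Finset.HasAntidiagonal.mem_antidiagonal] at hp
      rw [walkExp_tilt, ← hZ, ← hp, pow_add, inv_pow]
      have : walkExp d p.1 (fun u => level L (height u) * tilt h (height u)) =
          Real.exp (h * L) * pathSum d φ 0 (level L) p.1 := by
        rw [pathSum, ← walkExp_const_mul]
        refine walkExp_congr fun l _ => ?_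
        rw [pot, sitePot_zero hφ, neg_zero, Real.exp_zero, mul_one]
        unfold level
        split_ifs with h0
        · rw [h0, tilt]; simp
        · simp
      rw [this]
      field_simp
    rw [Finset.sum_congr rfl e3, ← Finset.mul_sum] at e2
    have e4 : ∑ p ∈ Finset.HasAntidiagonal.antidiagonal N,
        Z⁻¹ ^ p.1 * pathSum d φ 0 (level L) p.1 ≤ pathGF d φ (Real.log Z) 0 L := by
      rw [Finset.Nat.sum_antidiagonal_eq_sum_range_succ_mk]
      have hs := summable_pathGF (d := d) hφ (log_stepMgf_pos (d := d) hh) le_rfl L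
      rw [exp_neg_log_stepMgf hh.le] at hs
      rw [pathGF, exp_neg_log_stepMgf hh.le]
      exact hs.sum_le_tsum _ fun n _ =>
        mul_nonneg (by positivity) (pathSum_nonneg (level_nonneg L) n)
    have e5 : Z ^ N ≤ Z ^ N * (Real.exp (h * L) * pathGF d φ (Real.log Z) 0 L) +
        Real.exp (h * L) := by
      refine e1.trans (add_le_add_left (e2.trans ?_) _)
      rw [mul_assoc]
      gcongr
    have e6 : Real.exp (h * L) * Z⁻¹ ^ N * Z ^ N = Real.exp (h * L) := by
      rw [mul_assoc, ← mul_pow, inv_mul_cancel₀ hZ0.ne', one_pow, mul_one]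
    have hZN : 0 < Z ^ N := by positivity
    nlinarith
  have hlim : Tendsto (fun N : ℕ => 1 - Real.exp (h * L) * Z⁻¹ ^ N) atTop (𝓝 1) := by
    have := ((tendsto_pow_atTop_nhds_zero_of_lt_one (by positivity)
      (inv_lt_one_of_one_lt₀ hZ1)).const_mul (Real.exp (h * L))).const_sub 1
    simpa using this
  have := le_of_tendsto' hlim hN
  rw [Real.exp_neg, inv_le_iff_one_le_mul₀' (Real.exp_pos _)]
  exact this

lemma planeMass_log_stepMgf_le (hφ : IsPotential φ) {h : ℝ} (hh : 0 < h) :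
    planeMass d φ (Real.log (stepMgf d h)) 0 ≤ h := by
  refine le_of_tendsto (tendsto_log_pathGF hφ (log_stepMgf_pos hh) le_rfl) ?_
  filter_upwards [eventually_ge_atTop 1] with L hL
  have hL0 : (0 : ℝ) < L := by exact_mod_cast hL
  rw [div_le_iff₀ hL0]
  have := Real.log_le_log (Real.exp_pos _) (exp_neg_le_pathGF (d := d) hφ hh L)
  rw [Real.log_exp] at this
  linarith

/-- The limit of the mass as `λ ↓ 0`, which is the infimum by monotonicity. -/
noncomputable def planeMassZero (d : ℕ) [NeZero d] (φ : ℝ → ℝ) (β : ℝ) : ℝ :=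
  sInf ((fun lam => planeMass d φ lam β) '' Ioi 0)

lemma bddBelow_planeMass (hφ : IsPotential φ) (hβ : 0 ≤ β) :
    BddBelow ((fun lam => planeMass d φ lam β) '' Ioi 0) :=
  ⟨φ β, by rintro _ ⟨lam, hl, rfl⟩; exact le_planeMass hφ hl hβ⟩

lemma tendsto_planeMassZero (hφ : IsPotential φ) (hβ : 0 ≤ β) :
    Tendsto (fun lam => planeMass d φ lam β) (𝓝[>] 0) (𝓝 (planeMassZero d φ β)) :=
  MonotoneOn.tendsto_nhdsGT (fun _ hx _ _ hxy => planeMass_mono_left hφ hx hxy hβ)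
    (bddBelow_planeMass hφ hβ)

lemma planeMassZero_le (hφ : IsPotential φ) (hl : 0 < lam) (hβ : 0 ≤ β) :
    planeMassZero d φ β ≤ planeMass d φ lam β :=
  csInf_le (bddBelow_planeMass hφ hβ) ⟨lam, hl, rfl⟩

lemma le_planeMassZero {c : ℝ} (h : ∀ lam, 0 < lam → c ≤ planeMass d φ lam β) :
    c ≤ planeMassZero d φ β := by
  refine le_csInf (nonempty_Ioi.image _) ?_
  rintro _ ⟨lam, hl, rfl⟩
  exact h lam hl

lemma concaveOn_planeMassZero (hφ : IsPotential φ) :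
    ConcaveOn ℝ (Ici 0) (planeMassZero d φ) := by
  refine ⟨convex_Ici 0, fun x hx y hy s t hs ht hst => le_planeMassZero fun lam hl => ?_⟩
  have hc : s * lam + t * lam = lam := by rw [← add_mul, hst, one_mul]
  have := planeMass_concave (d := d) hφ hl hl hx hy hs ht hst (by rwa [hc])
  rw [hc] at this
  refine le_trans (add_le_add ?_ ?_) this
  · exact mul_le_mul_of_nonneg_left (planeMassZero_le hφ hl hx) hs
  · exact mul_le_mul_of_nonneg_left (planeMassZero_le hφ hl hy) ht

/-- The mass at `λ = 0` is at least `φ(β)`, hence unbounded; by concavity it is strictly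
increasing. -/
lemma strictMonoOn_planeMassZero (hφ : IsPotential φ) :
    StrictMonoOn (planeMassZero d φ) (Ici 0) := by
  intro x hx y hy hxy
  obtain ⟨z, hyz, hz⟩ : ∃ z, y < z ∧ planeMassZero d φ x < planeMassZero d φ z := by
    obtain ⟨z, h1, h2⟩ := ((eventually_gt_atTop y).and
      (hφ.tendsto_top.eventually_gt_atTop (planeMassZero d φ x))).exists
    exact ⟨z, h1, h2.trans_le (le_planeMassZero fun lam hl => le_planeMass hφ hl (hy.trans h1.le))⟩
  by_contra! hle
  have hxz : 0 < z - x := by linarith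
  have := (concaveOn_planeMassZero (d := d) hφ).2 hx (show z ∈ Ici (0 : ℝ) from hy.trans hyz.le)
    (div_nonneg (sub_nonneg.2 hyz.le) hxz.le) (div_nonneg (sub_nonneg.2 hxy.le) hxz.le)
    (by field_simp; ring)
  have e : ((z - y) / (z - x)) • x + ((y - x) / (z - x)) • z = y := by
    simp only [smul_eq_mul]; field_simp; ring
  rw [e] at this
  simp only [smul_eq_mul] at this
  have hb : 0 < (y - x) / (z - x) := div_pos (by linarith) hxz
  have hab : (z - y) / (z - x) = 1 - (y - x) / (z - x) := by field_simp; ring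
  rw [hab] at this
  have := mul_pos hb (sub_pos.2 hz)
  linarith

/-- The mass at `λ = 0` is small for small `β` as `M(λ, β) ≤ M(λ + φ(β), 0)`, and at least `φ(β)`,
hence large, for large `β`; by concavity it is continuous in between. -/
lemma exists_planeMassZero_eq (hφ : IsPotential φ) {h : ℝ} (hh : 0 < h) :
    ∃ β, 0 < β ∧ planeMassZero d φ β = h := by
  have hlog := log_stepMgf_pos (d := d) (half_pos hh)
  obtain ⟨x, hx0, hx⟩ : ∃ x, 0 < x ∧ planeMassZero d φ x < h := by
    have hev := hφ.tendsto_zero.eventually (gt_mem_nhds (half_pos hlog))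
    obtain ⟨x, hx1, hx0 : 0 < x⟩ := (hev.and self_mem_nhdsWithin).exists
    refine ⟨x, hx0, lt_of_le_of_lt ?_ (half_lt_self hh)⟩
    have hp := hφ.nonneg x hx0.le
    refine (planeMassZero_le hφ (half_pos hlog) hx0.le).trans
      ((planeMass_le_zero_right hφ (half_pos hlog) hx0.le).trans ?_)
    exact (planeMass_mono_left hφ (by linarith) (by linarith) le_rfl).trans
      (planeMass_log_stepMgf_le hφ (half_pos hh))
  obtain ⟨z, hxz, hz⟩ := ((eventually_gt_atTop x).and
      (hφ.tendsto_top.eventually_gt_atTop h)).exists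
  have hz' : h < planeMassZero d φ z :=
    hz.trans_le (le_planeMassZero fun lam hl => le_planeMass hφ hl (hx0.trans hxz).le)
  have hcont : ContinuousOn (planeMassZero d φ) (Icc x z) := by
    have := (concaveOn_planeMassZero (d := d) hφ).continuousOn_interior
    rw [interior_Ici] at this
    exact this.mono fun y hy => hx0.trans_le hy.1
  obtain ⟨β, hβ, e⟩ := intermediate_value_Icc hxz.le hcont ⟨hx.le, hz'.le⟩
  exact ⟨β, hx0.trans_le hβ.1, e⟩

lemma tendsto_log_Gbar (hφ : IsPotential φ) {h : ℝ} (hh : 0 < h) (hβ : 0 ≤ β) :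
    Tendsto (fun L : ℕ => -Real.log (Gbar d φ h β L) / L) atTop
      (𝓝 (planeMass d φ (Real.log (stepMgf d h)) β - h)) := by
  have hl := log_stepMgf_pos (d := d) hh
  refine ((tendsto_log_pathGF hφ hl hβ).sub_const h).congr' ?_
  filter_upwards [eventually_ge_atTop 1] with L hL
  have hL0 : (0 : ℝ) < L := by exact_mod_cast hL
  have e : Gbar d φ h β L = Real.exp (h * L) * pathGF d φ (Real.log (stepMgf d h)) β L := by
    have hs := summable_pathGF (d := d) hφ hl hβ L
    rw [Gbar_eq hφ, pathGF, hs.tsum_eq_zero_add]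
    have h0 : pathSum d φ β (level L) 0 = 0 := by
      rw [pathSum, walkExp_zero, height_nil, level, if_neg (by omega), zero_mul]
    rw [h0, mul_zero, zero_add, exp_neg_log_stepMgf hh.le]
    simp only [inv_pow, inv_mul_eq_div]
  rw [e, Real.log_mul (Real.exp_pos _).ne' (pathGF_pos hφ hl hβ L).ne', Real.log_exp]
  field_simp
  ring

lemma tendsto_planeMass_log_stepMgf (hφ : IsPotential φ) (hβ : 0 ≤ β) :
    Tendsto (fun h => planeMass d φ (Real.log (stepMgf d h)) β - h) (𝓝[>] 0)
      (𝓝 (planeMassZero d φ β)) := by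
  have h1 : Tendsto (fun h => Real.log (stepMgf d h)) (𝓝[>] 0) (𝓝[>] 0) := by
    refine tendsto_nhdsWithin_iff.2 ⟨?_, ?_⟩
    · have : ContinuousAt (fun h => Real.log (stepMgf d h)) 0 :=
        continuous_stepMgf.continuousAt.log (stepMgf_pos le_rfl).ne'
      have h2 := this.tendsto
      simp only [stepMgf_zero, Real.log_one] at h2
      exact h2.mono_left nhdsWithin_le_nhds
    · filter_upwards [self_mem_nhdsWithin] with h hh using log_stepMgf_pos hh
  have h2 := ((tendsto_planeMassZero (d := d) hφ hβ).comp h1).sub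
    (tendsto_id.mono_left (nhdsWithin_le_nhds (a := (0 : ℝ)) (s := Ioi 0)))
  simpa using h2

/-- The continuous extension to `h = 0` in the definition of the point-to-hyperplane mass is forced
to be the limit of the masses as `λ ↓ 0`. -/
lemma isHyperplaneMass_zero (hφ : IsPotential φ) (hβ : 0 ≤ β) {m : ℝ → ℝ}
    (hm : IsHyperplaneMass d φ β m) : m 0 = planeMassZero d φ β := by
  have h1 : Tendsto m (𝓝[>] 0) (𝓝 (m 0)) :=
    (hm.1 0 self_mem_Ici).mono_left (nhdsWithin_mono _ Ioi_subset_Ici_self)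
  refine tendsto_nhds_unique h1 ((tendsto_planeMass_log_stepMgf hφ hβ).congr' ?_)
  filter_upwards [self_mem_nhdsWithin] with h hh
  exact tendsto_nhds_unique (tendsto_log_Gbar hφ hh hβ) (hm.2 h hh)

lemma exists_isHyperplaneMass (hφ : IsPotential φ) (hβ : 0 ≤ β) :
    ∃ m, IsHyperplaneMass d φ β m := by
  classical
  refine ⟨Function.update (fun h => planeMass d φ (Real.log (stepMgf d h)) β - h) 0
    (planeMassZero d φ β), ?_, fun h hh => ?_⟩
  · intro h hh
    rcases (show (0 : ℝ) ≤ h from hh).eq_or_lt with rfl | h0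
    · rw [continuousWithinAt_update_same, Ici_sdiff_left]
      exact tendsto_planeMass_log_stepMgf hφ hβ
    · refine ContinuousAt.continuousWithinAt ((continuousAt_update_of_ne h0.ne').2 ?_)
      have h1 := (continuousOn_planeMass (d := d) hφ hβ).continuousAt
        (Ioi_mem_nhds (log_stepMgf_pos (d := d) h0))
      have h2 : ContinuousAt (fun h => Real.log (stepMgf d h)) h :=
        continuous_stepMgf.continuousAt.log (stepMgf_pos h0.le).ne'
      exact (ContinuousAt.comp (f := fun h => Real.log (stepMgf d h)) h1 h2).sub continuousAt_id
  · rw [Function.update_of_ne hh.ne']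
    exact tendsto_log_Gbar hφ hh hβ

lemma isCriticalParameter_iff (hφ : IsPotential φ) {h βc : ℝ} :
    IsCriticalParameter d φ h βc ↔ 0 < βc ∧ planeMassZero d φ βc = h := by
  refine and_congr_right fun hpos => ⟨?_, fun e => ?_⟩
  · rintro ⟨m, hm, rfl⟩
    exact (isHyperplaneMass_zero hφ hpos.le hm).symm
  · obtain ⟨m, hm⟩ := exists_isHyperplaneMass (d := d) hφ hpos.le
    exact ⟨m, hm, (isHyperplaneMass_zero hφ hpos.le hm).trans e⟩

lemma existsUnique_isCriticalParameter (hφ : IsPotential φ) {h : ℝ} (hh : 0 < h) :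
    ∃! βc, IsCriticalParameter d φ h βc := by
  simp only [isCriticalParameter_iff hφ]
  obtain ⟨β, hβ, e⟩ := exists_planeMassZero_eq (d := d) hφ hh
  exact ⟨β, ⟨hβ, e⟩, fun β' h' => (strictMonoOn_planeMassZero hφ).injOn
    (show β' ∈ Ici (0 : ℝ) from h'.1.le) (show β ∈ Ici (0 : ℝ) from hβ.le) (h'.2.trans e.symm)⟩

end PlaneMass

/-! ### The bridge mass -/

section BridgeMass

variable {d : ℕ} [NeZero d] {φ : ℝ → ℝ} {h β : ℝ}

lemma B_pos (hφ : IsPotential φ) (hh : 0 ≤ h) (β : ℝ) (N : ℕ) : 0 < B d φ h β N := by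
  rw [B_eq hφ]
  exact div_pos (bridgeSum_pos (tilt_nonneg h) (tilt_pos h _)) (pow_pos (stepMgf_pos hh) N)

lemma B_mul_le (hφ : IsPotential φ) (hh : 0 ≤ h) (hβ : 0 ≤ β) (N M : ℕ) :
    B d φ h β N * B d φ h β M ≤ B d φ h β (N + M) := by
  simp only [B_eq hφ]
  rw [div_mul_div_comm, ← pow_add]
  exact div_le_div_of_nonneg_right (bridgeSum_mul_le hφ hβ (tilt_nonneg h)
    (fun x y => (tilt_add h x y).ge) N M) (pow_pos (stepMgf_pos hh) _).le

lemma pathSum_tilt_zero (hφ : IsPotential φ) (h : ℝ) (N : ℕ) :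
    pathSum d φ 0 (tilt h) N = stepMgf d h ^ N := by
  rw [← walkExp_tilt, pathSum]
  simp [pot, sitePot_zero hφ]

lemma pathSum_anti (hφ : IsPotential φ) (hβ : 0 ≤ β) {k : ℤ → ℝ}
    (hk : ∀ x, 0 ≤ k x) (N : ℕ) : pathSum d φ β k N ≤ pathSum d φ 0 k N :=
  walkExp_mono fun _ _ => mul_le_mul_of_nonneg_left
    (Real.exp_le_exp.2 (neg_le_neg (sitePot_mono hφ le_rfl hβ _))) (hk _)

lemma B_le_G (hφ : IsPotential φ) (hh : 0 ≤ h) (N : ℕ) : B d φ h β N ≤ G d φ h β N := by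
  rw [B_eq hφ, G_eq hφ]
  exact div_le_div_of_nonneg_right (bridgeSum_le_pathSum (tilt_nonneg h) N)
    (pow_pos (stepMgf_pos hh) _).le

lemma B_le_one (hφ : IsPotential φ) (hh : 0 ≤ h) (hβ : 0 ≤ β) (N : ℕ) : B d φ h β N ≤ 1 := by
  rw [B_eq hφ, div_le_one (pow_pos (stepMgf_pos hh) _), ← pathSum_tilt_zero hφ]
  exact (bridgeSum_le_pathSum (tilt_nonneg h) N).trans (pathSum_anti hφ hβ (tilt_nonneg h) N)

lemma subadditive_log_B (hφ : IsPotential φ) (hh : 0 ≤ h) (hβ : 0 ≤ β) :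
    Subadditive fun N : ℕ => -Real.log (B d φ h β N) := by
  intro N M
  have h1 := B_pos (d := d) hφ hh β N
  have h2 := B_pos (d := d) hφ hh β M
  have := Real.log_le_log (mul_pos h1 h2) (B_mul_le hφ hh hβ N M)
  rw [Real.log_mul h1.ne' h2.ne'] at this
  linarith

lemma neg_log_B_nonneg (hφ : IsPotential φ) (hh : 0 ≤ h) (hβ : 0 ≤ β) (N : ℕ) :
    0 ≤ -Real.log (B d φ h β N) :=
  neg_nonneg.2 (Real.log_nonpos (B_pos hφ hh β N).le (B_le_one hφ hh hβ N))

lemma bddBelow_log_B (hφ : IsPotential φ) (hh : 0 ≤ h) (hβ : 0 ≤ β) :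
    BddBelow (range fun N : ℕ => -Real.log (B d φ h β N) / N) :=
  ⟨0, by rintro _ ⟨N, rfl⟩; exact div_nonneg (neg_log_B_nonneg hφ hh hβ N) (Nat.cast_nonneg N)⟩

/-- The limit defining `m_B` exists, so that `limUnder` is not a junk value. -/
lemma tendsto_bridgeMass (hφ : IsPotential φ) (hh : 0 ≤ h) (hβ : 0 ≤ β) :
    Tendsto (fun N : ℕ => -Real.log (B d φ h β N) / N) atTop (𝓝 (bridgeMass d φ h β)) :=
  tendsto_nhds_limUnder
    ⟨_, (subadditive_log_B hφ hh hβ).tendsto_lim (bddBelow_log_B hφ hh hβ)⟩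

lemma bridgeMass_nonneg (hφ : IsPotential φ) (hh : 0 ≤ h) (hβ : 0 ≤ β) :
    0 ≤ bridgeMass d φ h β :=
  ge_of_tendsto' (tendsto_bridgeMass hφ hh hβ) fun N =>
    div_nonneg (neg_log_B_nonneg hφ hh hβ N) (Nat.cast_nonneg N)

lemma B_le_exp (hφ : IsPotential φ) (hh : 0 ≤ h) (hβ : 0 ≤ β) (N : ℕ) :
    B d φ h β N ≤ Real.exp (-bridgeMass d φ h β * N) := by
  rcases Nat.eq_zero_or_pos N with rfl | hN
  · simpa using B_le_one (d := d) hφ hh hβ 0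
  have hN0 : (0 : ℝ) < N := by exact_mod_cast hN
  have hsub := subadditive_log_B (d := d) hφ hh hβ
  have hle := hsub.lim_le_div (bddBelow_log_B hφ hh hβ) hN.ne'
  rw [tendsto_nhds_unique (hsub.tendsto_lim (bddBelow_log_B hφ hh hβ))
    (tendsto_bridgeMass hφ hh hβ), le_div_iff₀ hN0] at hle
  rw [← Real.log_le_iff_le_exp (B_pos hφ hh β N)]
  linarith

/-! ### Regularity of the bridge mass -/

lemma tendsto_log_bridgeSum (hφ : IsPotential φ) (hh : 0 ≤ h) (hβ : 0 ≤ β) :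
    Tendsto (fun N : ℕ => -Real.log (bridgeSum d φ β (tilt h) N) / N) atTop
      (𝓝 (bridgeMass d φ h β - Real.log (stepMgf d h))) := by
  refine ((tendsto_bridgeMass hφ hh hβ).sub_const _).congr' ?_
  filter_upwards [eventually_ge_atTop 1] with N hN
  have hN0 : (N : ℝ) ≠ 0 := by positivity
  rw [B_eq hφ, Real.log_div (bridgeSum_pos (tilt_nonneg h) (tilt_pos h _)).ne'
    (pow_pos (stepMgf_pos hh) _).ne', Real.log_pow]
  field_simp
  ring

/-- An exponential comparison of bridge sums yields a comparison of bridge masses. -/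
lemma bridgeMass_sub_le (hφ : IsPotential φ) {h' β' c : ℝ} (hh : 0 ≤ h) (hβ : 0 ≤ β)
    (hh' : 0 ≤ h') (hβ' : 0 ≤ β')
    (hle : ∀ l : List (Step d), BridgeList l → tilt h (height l) * Real.exp (-pot φ β l) ≤
      Real.exp (c * l.length) * (tilt h' (height l) * Real.exp (-pot φ β' l))) :
    bridgeMass d φ h' β' - Real.log (stepMgf d h') ≤
      bridgeMass d φ h β - Real.log (stepMgf d h) + c := by
  refine le_of_tendsto_of_tendsto (tendsto_log_bridgeSum hφ hh' hβ')
    ((tendsto_log_bridgeSum hφ hh hβ).add_const c) ?_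
  filter_upwards [eventually_ge_atTop 1] with N hN
  have hN0 : (0 : ℝ) < N := by exact_mod_cast hN
  have h1 : Real.exp (-(c * N)) * bridgeSum d φ β (tilt h) N ≤ bridgeSum d φ β' (tilt h') N := by
    refine bridgeSum_le_of_bridge fun l hl hb => ?_
    have := mul_le_mul_of_nonneg_left (hle l hb) (Real.exp_pos (-(c * N))).le
    rwa [← mul_assoc _ (Real.exp (c * l.length)), ← Real.exp_add, hl, neg_add_cancel,
      Real.exp_zero, one_mul] at this
  have hp := bridgeSum_pos (d := d) (φ := φ) (β := β) (tilt_nonneg h) (tilt_pos h N)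
  have := Real.log_le_log (mul_pos (Real.exp_pos _) hp) h1
  rw [Real.log_mul (Real.exp_pos _).ne' hp.ne', Real.log_exp] at this
  rw [div_add' _ _ _ hN0.ne']
  exact div_le_div_of_nonneg_right (by linarith) hN0.le

/-- Bridges of length `N` end between the levels `0` and `N`, so that
`m_B(h, β) - log E_0[e^{h S₁(1)}]` decreases in `h` with slope at most `1`. -/
lemma bridgeMass_sub_log_anti (hφ : IsPotential φ) {h' : ℝ} (hh : 0 ≤ h) (hhh : h ≤ h')
    (hβ : 0 ≤ β) :
    bridgeMass d φ h' β - Real.log (stepMgf d h') ≤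
      bridgeMass d φ h β - Real.log (stepMgf d h) := by
  have := bridgeMass_sub_le (d := d) (c := 0) hφ hh hβ (hh.trans hhh) hβ fun l hl => by
    rw [zero_mul, Real.exp_zero, one_mul]
    refine mul_le_mul_of_nonneg_right (Real.exp_le_exp.2 ?_) (Real.exp_pos _).le
    have : (0 : ℝ) ≤ height l := by exact_mod_cast hl.height_nonneg
    gcongr
  simpa using this

lemma bridgeMass_sub_log_le_add (hφ : IsPotential φ) {h' : ℝ} (hh : 0 ≤ h) (hhh : h ≤ h')
    (hβ : 0 ≤ β) :
    bridgeMass d φ h β - Real.log (stepMgf d h) ≤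
      bridgeMass d φ h' β - Real.log (stepMgf d h') + (h' - h) := by
  refine bridgeMass_sub_le hφ (hh.trans hhh) hβ hh hβ fun l _ => ?_
  rw [← mul_assoc]
  refine mul_le_mul_of_nonneg_right ?_ (Real.exp_pos _).le
  rw [tilt, tilt, ← Real.exp_add]
  refine Real.exp_le_exp.2 ?_
  have : (height l : ℝ) ≤ l.length := by exact_mod_cast height_le_length l
  nlinarith

lemma bridgeMass_mono (hφ : IsPotential φ) {β' : ℝ} (hh : 0 ≤ h) (hβ : 0 ≤ β) (hββ : β ≤ β') :
    bridgeMass d φ h β ≤ bridgeMass d φ h β' := by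
  have := bridgeMass_sub_le (d := d) (c := 0) hφ hh (hβ.trans hββ) hh hβ fun l _ => by
    rw [zero_mul, Real.exp_zero, one_mul]
    exact mul_le_mul_of_nonneg_left (Real.exp_le_exp.2 (neg_le_neg (sitePot_mono hφ hβ hββ _)))
      (tilt_nonneg _ _)
  linarith

lemma bridgeMass_scale_le (hφ : IsPotential φ) {c : ℝ} (hh : 0 ≤ h) (hβ : 0 ≤ β) (hc : 1 ≤ c) :
    bridgeMass d φ h (c * β) ≤ bridgeMass d φ h β + (c - 1) * φ β := by
  have := bridgeMass_sub_le (d := d) (c := (c - 1) * φ β) hφ hh hβ hh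
    (β' := c * β) (mul_nonneg (by linarith) hβ) fun l _ => by
    rw [mul_left_comm, ← Real.exp_add]
    refine mul_le_mul_of_nonneg_left (Real.exp_le_exp.2 ?_) (tilt_nonneg _ _)
    have h1 : pot φ (c * β) l ≤ c * pot φ β l := sitePot_scale_le hφ hβ hc _
    have h2 : pot φ β l ≤ l.length * φ β := by
      simpa [pot] using sitePot_le_length hφ hβ (visits l)
    nlinarith
  linarith

lemma bridgeMass_le_add (hφ : IsPotential φ) (hh : 0 ≤ h) (hβ : 0 ≤ β) :
    bridgeMass d φ h β ≤ bridgeMass d φ h 0 + φ β := by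
  have := bridgeMass_sub_le (d := d) (c := φ β) hφ hh le_rfl hh hβ fun l _ => by
    rw [mul_left_comm, ← Real.exp_add]
    refine mul_le_mul_of_nonneg_left (Real.exp_le_exp.2 ?_) (tilt_nonneg _ _)
    have h2 : pot φ β l ≤ l.length * φ β := by
      simpa [pot] using sitePot_le_length hφ hβ (visits l)
    have h3 : pot φ 0 l = 0 := sitePot_zero hφ _
    linarith
  linarith

/-! ### Below the critical parameter -/

/-- Below the critical parameter, bridges decay slower than returns to the initial hyperplane. -/
lemma bridgeMass_lt_log_stepMgf (hφ : IsPotential φ) (hh : 0 ≤ h) (hβ : 0 ≤ β)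
    (hlt : planeMassZero d φ β < h) : bridgeMass d φ h β < Real.log (stepMgf d h) := by
  by_contra! hle
  have hZ := stepMgf_pos (d := d) hh
  have hone : ∀ N, bridgeSum d φ β (tilt h) N ≤ 1 := by
    intro N
    have h1 := B_le_exp (d := d) hφ hh hβ N
    have h2 : Real.exp (-bridgeMass d φ h β * N) ≤ (stepMgf d h ^ N)⁻¹ := by
      rw [← Real.exp_log (pow_pos hZ N), ← Real.exp_neg, Real.log_pow]
      refine Real.exp_le_exp.2 ?_
      have : (0 : ℝ) ≤ N := Nat.cast_nonneg N
      nlinarith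
    have h3 := h1.trans h2
    rwa [B_eq hφ, div_le_iff₀ (pow_pos hZ N), inv_mul_cancel₀ (pow_pos hZ N).ne'] at h3
  refine absurd (le_planeMassZero fun lam hl => ?_) (not_le.2 hlt)
  refine le_planeMass_of_bridgeGF_le hφ hl hβ fun L =>
    tsum_pow_mul_le hl (bridgeSum_nonneg (level_nonneg L)) fun N => ?_
  have h1 : Real.exp (L * h) * bridgeSum d φ β (level L) N ≤ bridgeSum d φ β (tilt h) N := by
    refine bridgeSum_le_of_bridge fun l _ _ => ?_
    unfold level
    split_ifs with h0
    · rw [tilt, h0, one_mul, mul_comm h]; simp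
    · simp only [zero_mul, mul_zero]
      exact mul_nonneg (tilt_nonneg _ _) (Real.exp_pos _).le
  rw [Real.exp_neg, ← one_div, le_div_iff₀' (Real.exp_pos _)]
  exact h1.trans (hone N)

lemma returnProb_nonneg (hh : 0 ≤ h) (n : ℕ) : 0 ≤ returnProb d h n := by
  rw [returnProb_eq]
  exact div_nonneg (retSum_nonneg n) (pow_pos (stepMgf_pos hh) n).le

lemma summable_returnProb_div (hφ : IsPotential φ) (hh : 0 ≤ h) (hβ : 0 ≤ β)
    (hlt : bridgeMass d φ h β < Real.log (stepMgf d h)) :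
    Summable fun n => returnProb d h n / B d φ h β n := by
  obtain ⟨r, hr1, hr2⟩ := exists_between hlt
  have hgeo : Summable fun n : ℕ => Real.exp (-(Real.log (stepMgf d h) - r)) ^ n :=
    (hasSum_geo (sub_pos.2 hr2)).summable
  refine hgeo.of_norm_bounded_eventually_nat ?_
  filter_upwards [(tendsto_bridgeMass (d := d) hφ hh hβ).eventually_lt_const hr1,
    eventually_ge_atTop 1] with n hn hn1
  have hn0 : (0 : ℝ) < n := by exact_mod_cast hn1
  have hB := B_pos (d := d) hφ hh β n
  rw [Real.norm_of_nonneg (div_nonneg (returnProb_nonneg hh n) hB.le), div_le_iff₀ hB]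
  rw [div_lt_iff₀ hn0] at hn
  have h1 : Real.exp (-(r * n)) ≤ B d φ h β n := by
    rw [← Real.le_log_iff_exp_le hB]; linarith
  have h2 : returnProb d h n ≤ Real.exp (-(Real.log (stepMgf d h) * n)) := by
    rw [returnProb_eq, mul_comm, ← Real.log_pow, Real.exp_neg,
      Real.exp_log (pow_pos (stepMgf_pos hh) n), ← one_div]
    exact div_le_div_of_nonneg_right (retSum_le_one n) (pow_pos (stepMgf_pos hh) n).le
  refine h2.trans (le_trans (le_of_eq ?_) (mul_le_mul_of_nonneg_left h1 (by positivity)))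
  rw [← Real.exp_nat_mul, ← Real.exp_add]
  ring_nf

lemma K_eq (hφ : IsPotential φ) (hh : 0 ≤ h)
    (hs : Summable fun n => returnProb d h n / B d φ h β n) :
    K d φ h β = ENNReal.ofReal ((∑' n, returnProb d h n / B d φ h β n) ^ 2) := by
  have h0 : ∀ n, 0 ≤ returnProb d h n / B d φ h β n := fun n =>
    div_nonneg (returnProb_nonneg hh n) (B_pos hφ hh β n).le
  rw [K, ENNReal.ofReal_pow (tsum_nonneg h0), ENNReal.ofReal_tsum_of_nonneg h0 hs]
  simp only [ENNReal.ofReal_div_of_pos (B_pos hφ hh β _)]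

lemma B_anti (hφ : IsPotential φ) {β' : ℝ} (hh : 0 ≤ h) (hβ : 0 ≤ β) (hββ : β ≤ β') (N : ℕ) :
    B d φ h β' N ≤ B d φ h β N := by
  rw [B_eq hφ, B_eq hφ]
  exact div_le_div_of_nonneg_right (bridgeSum_anti hφ hβ hββ (tilt_nonneg h) N)
    (pow_pos (stepMgf_pos hh) _).le

section Returns

variable {Q : ℝ}

/-- Returns attached to a bridge are absorbed into a bridge of the full length, at the cost of a
factor bounding `∑ₙ P_h[S₁(n) = 0] / B(n)`. -/
lemma sum_bridgeSum_mul_retSum_le (hφ : IsPotential φ) (hh : 0 ≤ h) (hβ : 0 ≤ β)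
    (hQ : ∀ N, ∑ n ∈ Finset.range N, returnProb d h n / B d φ h β n ≤ Q) (N : ℕ) :
    ∑ p ∈ Finset.HasAntidiagonal.antidiagonal N,
      bridgeSum d φ β (tilt h) p.1 * retSum d p.2 ≤ stepMgf d h ^ N * (Q * B d φ h β N) := by
  have hZ := stepMgf_pos (d := d) hh
  have hterm : ∀ p ∈ Finset.HasAntidiagonal.antidiagonal N,
      bridgeSum d φ β (tilt h) p.1 * retSum d p.2 ≤
        stepMgf d h ^ N * B d φ h β N * (returnProb d h p.2 / B d φ h β p.2) := by
    intro p hp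
    rw [Finset.HasAntidiagonal.mem_antidiagonal] at hp
    have hB := B_pos (d := d) hφ hh β p.2
    have e1 : bridgeSum d φ β (tilt h) p.1 = B d φ h β p.1 * stepMgf d h ^ p.1 := by
      rw [B_eq hφ, div_mul_cancel₀ _ (pow_pos hZ _).ne']
    have e2 : retSum d p.2 = returnProb d h p.2 * stepMgf d h ^ p.2 := by
      rw [returnProb_eq, div_mul_cancel₀ _ (pow_pos hZ _).ne']
    have h1 := B_mul_le (d := d) hφ hh hβ p.1 p.2
    rw [hp] at h1
    have h2 := mul_le_mul_of_nonneg_left h1 (mul_nonneg (pow_pos hZ N).le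
      (div_nonneg (returnProb_nonneg (d := d) hh p.2) hB.le))
    refine (le_of_eq ?_).trans (h2.trans (le_of_eq ?_))
    · rw [e1, e2, ← hp, pow_add]; field_simp
    · ring
  refine (Finset.sum_le_sum hterm).trans ?_
  rw [← Finset.mul_sum, mul_assoc, mul_comm Q]
  refine mul_le_mul_of_nonneg_left ?_ (pow_pos hZ N).le
  refine mul_le_mul_of_nonneg_left ?_ (B_pos hφ hh β N).le
  rw [← Finset.Nat.sum_antidiagonal_swap]
  simp only [Prod.snd_swap]
  rw [Finset.Nat.sum_antidiagonal_eq_sum_range_succ_mk]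
  exact hQ _

lemma sum_retSum_mul_bridgeSum_le (hφ : IsPotential φ) (hh : 0 ≤ h) (hβ : 0 ≤ β)
    (hQ : ∀ N, ∑ n ∈ Finset.range N, returnProb d h n / B d φ h β n ≤ Q) (N : ℕ) :
    ∑ p ∈ Finset.HasAntidiagonal.antidiagonal N,
      retSum d p.1 * bridgeSum d φ β (tilt h) p.2 ≤ stepMgf d h ^ N * (Q * B d φ h β N) := by
  rw [← Finset.Nat.sum_antidiagonal_swap]
  simp only [Prod.snd_swap, Prod.fst_swap, mul_comm (retSum d _)]
  exact sum_bridgeSum_mul_retSum_le hφ hh hβ hQ N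

lemma B_add_le (hφ : IsPotential φ) (hh : 0 ≤ h) (hβ : 0 ≤ β)
    (hQ : ∀ N, ∑ n ∈ Finset.range N, returnProb d h n / B d φ h β n ≤ Q) (N M : ℕ) :
    B d φ h β (N + M) ≤ Q ^ 2 * (B d φ h β N * B d φ h β M) := by
  have hZ := stepMgf_pos (d := d) hh
  have hQ0 : 0 ≤ Q := by simpa using hQ 0
  rw [B_eq hφ h β (N + M), div_le_iff₀ (pow_pos hZ _)]
  refine (bridgeSum_add_le hφ hβ (tilt_nonneg h) (tilt_nonneg h)
    (fun x y => (tilt_add h x y).le) N M).trans ?_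
  refine (mul_le_mul (sum_bridgeSum_mul_retSum_le hφ hh hβ hQ N)
    (sum_retSum_mul_bridgeSum_le hφ hh hβ hQ M)
    (Finset.sum_nonneg fun _ _ => mul_nonneg (retSum_nonneg _) (bridgeSum_nonneg (tilt_nonneg h) _))
    (mul_nonneg (pow_pos hZ N).le (mul_nonneg hQ0 (B_pos hφ hh β N).le))).trans_eq ?_
  rw [pow_add]
  ring

/-- Since `Q² B` is submultiplicative, Fekete's lemma bounds it from below by its exponential
rate. -/
lemma exp_le_B (hφ : IsPotential φ) (hh : 0 ≤ h) (hβ : 0 ≤ β)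
    (hQ : ∀ N, ∑ n ∈ Finset.range N, returnProb d h n / B d φ h β n ≤ Q) {N : ℕ} (hN : 1 ≤ N) :
    0 < Q ^ 2 ∧ Real.exp (-bridgeMass d φ h β * N) ≤ Q ^ 2 * B d φ h β N := by
  have hB := fun n => B_pos (d := d) hφ hh β n
  have hQ2 : 0 < Q ^ 2 := by
    refine pos_of_mul_pos_left ((hB (0 + 0)).trans_le (B_add_le hφ hh hβ hQ 0 0)) ?_
    exact (mul_pos (hB 0) (hB 0)).le
  refine ⟨hQ2, ?_⟩
  have hsub : Subadditive fun n : ℕ => Real.log (Q ^ 2 * B d φ h β n) := by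
    intro n m
    have hn := hB n
    have hm := hB m
    rw [← Real.log_mul (by positivity) (by positivity)]
    refine Real.log_le_log (mul_pos hQ2 (hB _)) ?_
    have := mul_le_mul_of_nonneg_left (B_add_le (d := d) hφ hh hβ hQ n m) hQ2.le
    linarith
  have hlim : Tendsto (fun n : ℕ => Real.log (Q ^ 2 * B d φ h β n) / n) atTop
      (𝓝 (-bridgeMass d φ h β)) := by
    have := (tendsto_const_div_nat (Real.log (Q ^ 2))).add
      (tendsto_bridgeMass (d := d) hφ hh hβ).neg
    rw [zero_add] at this
    refine this.congr fun n => ?_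
    rw [Real.log_mul hQ2.ne' (hB n).ne']
    ring
  have hbdd : BddBelow (range fun n : ℕ => Real.log (Q ^ 2 * B d φ h β n) / n) :=
    hlim.bddBelow_range
  have hN0 : (0 : ℝ) < N := by exact_mod_cast hN
  have := hsub.lim_le_div hbdd (n := N) (by omega)
  rw [tendsto_nhds_unique (hsub.tendsto_lim hbdd) hlim, le_div_iff₀ hN0] at this
  rwa [← Real.le_log_iff_exp_le (mul_pos hQ2 (hB N))]

/-- Paths ending in the upper half-space are compared with bridges; the remaining ones have
probability at most `E_0[e^{h S₁(1)}]^{-N}`. -/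
lemma G_le (hφ : IsPotential φ) (hh : 0 ≤ h) (hβ : 0 ≤ β)
    (hQ : ∀ N, ∑ n ∈ Finset.range N, returnProb d h n / B d φ h β n ≤ Q) (N : ℕ) :
    G d φ h β N ≤ Q ^ 2 * B d φ h β N + (stepMgf d h ^ N)⁻¹ := by
  have hZ := stepMgf_pos (d := d) hh
  have hQ0 : 0 ≤ Q := by simpa using hQ 0
  set k : ℤ → ℝ := fun x => if x < 0 then 0 else tilt h x with hk
  have hk0 : ∀ x, 0 ≤ k x := fun x => by
    simp only [hk]; split_ifs; exacts [le_rfl, tilt_nonneg h x]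
  have hkt : ∀ x, k x ≤ tilt h x := fun x => by
    simp only [hk]; split_ifs; exacts [tilt_nonneg h x, le_rfl]
  have h1 : pathSum d φ β (tilt h) N ≤ pathSum d φ β k N + 1 := by
    rw [← walkExp_const (d := d) N 1, pathSum, pathSum, ← walkExp_add_fun]
    refine walkExp_mono fun l _ => ?_
    simp only [hk]
    split_ifs with hl
    · rw [zero_mul, zero_add]
      refine mul_le_one₀ (Real.exp_le_one_iff.2 ?_) (Real.exp_pos _).le
        (exp_neg_pot_le_one hφ hβ l)
      exact mul_nonpos_of_nonneg_of_nonpos hh (by exact_mod_cast hl.le)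
    · linarith
  have h2 : pathSum d φ β k N ≤ stepMgf d h ^ N * (Q ^ 2 * B d φ h β N) := by
    refine (pathSum_le hφ hβ hk0 (fun x hx => if_pos hx) N).trans ?_
    have h3 : ∀ n, ∑ q ∈ Finset.HasAntidiagonal.antidiagonal n,
        bridgeSum d φ β k q.1 * retSum d q.2 ≤ Q * bridgeSum d φ β (tilt h) n := by
      intro n
      have e : stepMgf d h ^ n * (Q * B d φ h β n) = Q * bridgeSum d φ β (tilt h) n := by
        have := (pow_pos hZ n).ne'
        rw [B_eq hφ]; field_simp
      rw [← e]
      refine le_trans (Finset.sum_le_sum fun q _ => ?_) (sum_bridgeSum_mul_retSum_le hφ hh hβ hQ n)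
      refine mul_le_mul_of_nonneg_right ?_ (retSum_nonneg _)
      rw [← one_mul (bridgeSum d φ β k q.1)]
      refine bridgeSum_le_of_bridge fun l _ _ => ?_
      rw [one_mul]
      exact mul_le_mul_of_nonneg_right (hkt _) (Real.exp_pos _).le
    refine (Finset.sum_le_sum fun p _ => mul_le_mul_of_nonneg_left (h3 p.2)
      (retSum_nonneg p.1)).trans ?_
    simp only [mul_left_comm _ Q]
    rw [← Finset.mul_sum]
    refine (mul_le_mul_of_nonneg_left (sum_retSum_mul_bridgeSum_le hφ hh hβ hQ N) hQ0).trans_eq ?_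
    ring
  rw [G_eq hφ, div_le_iff₀ (pow_pos hZ N), add_mul, inv_mul_cancel₀ (pow_pos hZ N).ne']
  linarith

lemma tendsto_log_G (hφ : IsPotential φ) (hh : 0 ≤ h) (hβ : 0 ≤ β)
    (hlt : bridgeMass d φ h β < Real.log (stepMgf d h)) :
    Tendsto (fun N : ℕ => -Real.log (G d φ h β N) / N) atTop (𝓝 (bridgeMass d φ h β)) := by
  have hZ := stepMgf_pos (d := d) hh
  have hB := fun n => B_pos (d := d) hφ hh β n
  have hQ : ∀ N, ∑ n ∈ Finset.range N, returnProb d h n / B d φ h β n ≤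
      ∑' n, returnProb d h n / B d φ h β n := fun N =>
    (summable_returnProb_div hφ hh hβ hlt).sum_le_tsum _ fun n _ =>
      div_nonneg (returnProb_nonneg hh n) (hB n).le
  set Q := ∑' n, returnProb d h n / B d φ h β n
  have hQ2 : 0 < Q ^ 2 := (exp_le_B hφ hh hβ hQ le_rfl).1
  have h1 := (tendsto_bridgeMass (d := d) hφ hh hβ).sub
    (tendsto_const_div_nat (Real.log (2 * Q ^ 2)))
  rw [sub_zero] at h1
  refine tendsto_of_tendsto_of_tendsto_of_le_of_le' h1 (tendsto_bridgeMass hφ hh hβ) ?_ ?_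
  · filter_upwards [eventually_ge_atTop 1] with N hN
    have h2 := (exp_le_B hφ hh hβ hQ hN).2
    have h3 : (stepMgf d h ^ N)⁻¹ ≤ Real.exp (-bridgeMass d φ h β * N) := by
      rw [← Real.exp_log (pow_pos hZ N), ← Real.exp_neg, Real.log_pow]
      refine Real.exp_le_exp.2 ?_
      have : (0 : ℝ) ≤ N := Nat.cast_nonneg N
      nlinarith
    have h4 : G d φ h β N ≤ 2 * Q ^ 2 * B d φ h β N := by
      have := G_le hφ hh hβ hQ N
      linarith
    have h5 := Real.log_le_log ((hB N).trans_le (B_le_G hφ hh N)) h4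
    rw [Real.log_mul (by positivity) (hB N).ne'] at h5
    rw [← sub_div]
    exact div_le_div_of_nonneg_right (by linarith) (Nat.cast_nonneg N)
  · exact Eventually.of_forall fun N => div_le_div_of_nonneg_right
      (neg_le_neg (Real.log_le_log (hB N) (B_le_G hφ hh N))) (Nat.cast_nonneg N)

end Returns

/-! ### The bridge mass without potential, and continuity -/

/-- For `h > 0` the critical parameter is positive, so `β = 0` is subcritical, and there the
bridge mass is the mass of `G = 1`. The case `h = 0` follows from the modulus of continuity
in `h`. -/
lemma bridgeMass_zero (hφ : IsPotential φ) (hh : 0 ≤ h) : bridgeMass d φ h 0 = 0 := by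
  have hpos : ∀ h, 0 < h → bridgeMass d φ h 0 = 0 := by
    intro h hh
    obtain ⟨β, hβ, e⟩ := exists_planeMassZero_eq (d := d) hφ hh
    have hlt : planeMassZero d φ 0 < h :=
      e ▸ strictMonoOn_planeMassZero (d := d) hφ self_mem_Ici hβ.le hβ
    have h1 := tendsto_log_G hφ hh.le le_rfl (bridgeMass_lt_log_stepMgf hφ hh.le le_rfl hlt)
    refine tendsto_nhds_unique h1 (tendsto_const_nhds.congr fun N => ?_)
    rw [G_eq hφ, pathSum_tilt_zero hφ, div_self (pow_pos (stepMgf_pos hh.le) N).ne']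
    simp
  rcases hh.eq_or_lt with rfl | h0
  swap
  · exact hpos h h0
  refine le_antisymm (le_of_forall_pos_le_add fun ε hε => ?_) (bridgeMass_nonneg hφ le_rfl le_rfl)
  have := bridgeMass_sub_log_le_add (d := d) hφ le_rfl hε.le (le_refl (0 : ℝ))
  rw [hpos ε hε, stepMgf_zero, Real.log_one] at this
  have := log_stepMgf_pos (d := d) hε
  linarith

lemma bridgeMass_le (hφ : IsPotential φ) (hh : 0 ≤ h) (hβ : 0 ≤ β) :
    bridgeMass d φ h β ≤ φ β := by
  have := bridgeMass_le_add (d := d) hφ hh hβ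
  rwa [bridgeMass_zero hφ hh, zero_add] at this

lemma continuousOn_bridgeMass_right (hφ : IsPotential φ) (hh : 0 ≤ h) :
    ContinuousOn (fun β => bridgeMass d φ h β) (Ici 0) := by
  intro β₀ hβ₀
  rcases (show (0 : ℝ) ≤ β₀ from hβ₀).eq_or_lt with rfl | h0
  · change Tendsto (fun β => bridgeMass d φ h β) _ (𝓝 (bridgeMass d φ h 0))
    rw [bridgeMass_zero hφ hh]
    refine tendsto_of_tendsto_of_tendsto_of_le_of_le' tendsto_const_nhds hφ.tendsto_zero_right ?_ ?_
    · filter_upwards [self_mem_nhdsWithin] with β hβ using bridgeMass_nonneg hφ hh hβ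
    · filter_upwards [self_mem_nhdsWithin] with β hβ using bridgeMass_le hφ hh hβ
  · refine ContinuousAt.continuousWithinAt ?_
    have hp := hφ.nonneg β₀ h0.le
    -- on `β > β₀ / 2` the scaling bound gives a Lipschitz estimate at `β₀`
    have hbound : ∀ᶠ β in 𝓝 β₀, ‖bridgeMass d φ h β - bridgeMass d φ h β₀‖ ≤
        2 / β₀ * φ β₀ * |β - β₀| := by
      filter_upwards [lt_mem_nhds (half_lt_self h0)] with β hβ
      have hβ0 : 0 < β := (half_pos h0).trans hβ
      rcases le_total β₀ β with hle | hle
      · have h1 := bridgeMass_mono (d := d) hφ hh h0.le hle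
        have h2 := bridgeMass_scale_le (d := d) hφ hh h0.le ((one_le_div h0).2 hle)
        rw [div_mul_cancel₀ _ h0.ne'] at h2
        rw [Real.norm_of_nonneg (by linarith), abs_of_nonneg (by linarith)]
        have h3 : (β / β₀ - 1) * φ β₀ ≤ 2 / β₀ * φ β₀ * (β - β₀) := by
          have e : 2 / β₀ * φ β₀ * (β - β₀) = 2 * ((β / β₀ - 1) * φ β₀) := by field_simp
          rw [e]
          have : 0 ≤ (β / β₀ - 1) * φ β₀ :=
            mul_nonneg (sub_nonneg.2 ((one_le_div h0).2 hle)) hp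
          linarith
        linarith
      · have h1 := bridgeMass_mono (d := d) hφ hh hβ0.le hle
        have h2 := bridgeMass_scale_le (d := d) hφ hh hβ0.le ((one_le_div hβ0).2 hle)
        rw [div_mul_cancel₀ _ hβ0.ne'] at h2
        rw [norm_sub_rev, abs_sub_comm, Real.norm_of_nonneg (by linarith),
          abs_of_nonneg (by linarith)]
        have h3 : (β₀ / β - 1) * φ β ≤ 2 / β₀ * (β₀ - β) * φ β₀ := by
          refine mul_le_mul ?_ (hφ.mono hβ0.le h0.le hle) (hφ.nonneg _ hβ0.le)
            (mul_nonneg (by positivity) (by linarith))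
          rw [div_sub_one hβ0.ne', div_mul_eq_mul_div, div_le_div_iff₀ hβ0 h0]
          nlinarith
        linarith
    have hz : Tendsto (fun β => 2 / β₀ * φ β₀ * |β - β₀|) (𝓝 β₀) (𝓝 0) := by
      have : Continuous fun β => 2 / β₀ * φ β₀ * |β - β₀| := by fun_prop
      simpa using this.tendsto β₀
    have := squeeze_zero_norm' hbound hz
    exact tendsto_sub_nhds_zero_iff.1 this

lemma continuousOn_bridgeMass (hφ : IsPotential φ) :
    ContinuousOn (fun p : ℝ × ℝ => bridgeMass d φ p.1 p.2) (Ici 0 ×ˢ Ici 0) := by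
  have h1 : ContinuousOn (fun p : ℝ × ℝ => bridgeMass d φ p.1 p.2 - Real.log (stepMgf d p.1))
      (Ici 0 ×ˢ Ici 0) := by
    refine continuousOn_prod_of_continuousOn_lipschitzOnWith _ 1
      (fun h hh => (continuousOn_bridgeMass_right hφ hh).sub
        (continuousOn_const (c := Real.log (stepMgf d h))))
      (fun β hβ => LipschitzOnWith.of_dist_le_mul fun h hh h' hh' => ?_)
    rw [NNReal.coe_one, one_mul, Real.dist_eq, Real.dist_eq]
    rcases le_total h h' with hle | hle
    · have e1 := bridgeMass_sub_log_anti (d := d) hφ hh hle hβ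
      have e2 := bridgeMass_sub_log_le_add (d := d) hφ hh hle hβ
      rw [abs_of_nonneg (by linarith), abs_sub_comm, abs_of_nonneg (by linarith)]
      linarith
    · have e1 := bridgeMass_sub_log_anti (d := d) hφ hh' hle hβ
      have e2 := bridgeMass_sub_log_le_add (d := d) hφ hh' hle hβ
      rw [abs_sub_comm, abs_of_nonneg (by linarith), abs_of_nonneg (by linarith)]
      linarith
  have h2 : ContinuousOn (fun p : ℝ × ℝ => Real.log (stepMgf d p.1)) (Ici 0 ×ˢ Ici 0) :=
    (continuous_stepMgf.comp continuous_fst).continuousOn.log fun p hp => (stepMgf_pos hp.1).ne'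
  exact (h1.add h2).congr fun p _ => (sub_add_cancel _ _).symm

end BridgeMass

end DriftedWalk

theorem proposition3p5 (d : ℕ) [NeZero d] (φ : ℝ → ℝ) (hφ : DriftedWalk.IsPotential φ) :
    (∀ h β : ℝ, 0 ≤ h → 0 ≤ β →
      Tendsto (fun N : ℕ => -Real.log (DriftedWalk.B d φ h β N) / N) atTop
        (𝓝 (DriftedWalk.bridgeMass d φ h β)) ∧
      DriftedWalk.bridgeMass d φ h β ∈ Icc 0 (φ β) ∧
      ∀ N : ℕ, 1 ≤ N →
        DriftedWalk.B d φ h β N ≤ Real.exp (-DriftedWalk.bridgeMass d φ h β * N)) ∧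
    ContinuousOn (fun p : ℝ × ℝ => DriftedWalk.bridgeMass d φ p.1 p.2) (Ici 0 ×ˢ Ici 0) ∧
    ∀ h : ℝ, 0 < h →
      (∃! βc : ℝ, DriftedWalk.IsCriticalParameter d φ h βc) ∧
      ∀ βc : ℝ, DriftedWalk.IsCriticalParameter d φ h βc →
        (∀ β : ℝ, 0 ≤ β → β < βc →
          Tendsto (fun N : ℕ => -Real.log (DriftedWalk.G d φ h β N) / N) atTop
            (𝓝 (DriftedWalk.pathMass d φ h β)) ∧
          DriftedWalk.bridgeMass d φ h β = DriftedWalk.pathMass d φ h β) ∧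
        ∀ β₀ : ℝ, 0 ≤ β₀ → β₀ < βc →
          DriftedWalk.K d φ h β₀ < ⊤ ∧
          ∀ β : ℝ, 0 ≤ β → β ≤ β₀ → ∀ N : ℕ, 1 ≤ N →
            Real.exp (-DriftedWalk.bridgeMass d φ h β * N) / (DriftedWalk.K d φ h β₀).toReal
              ≤ DriftedWalk.B d φ h β N ∧
            Real.exp (-DriftedWalk.pathMass d φ h β * N) / (DriftedWalk.K d φ h β₀).toReal
              ≤ DriftedWalk.G d φ h β N := by
  open DriftedWalk in
  refine ⟨fun h β hh hβ => ⟨tendsto_bridgeMass hφ hh hβ,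
    ⟨bridgeMass_nonneg hφ hh hβ, bridgeMass_le hφ hh hβ⟩, fun N _ => B_le_exp hφ hh hβ N⟩,
    continuousOn_bridgeMass hφ, fun h hh => ⟨existsUnique_isCriticalParameter hφ hh,
    fun βc hβc => ?_⟩⟩
  obtain ⟨hβc0, hβc⟩ := (DriftedWalk.isCriticalParameter_iff hφ).1 hβc
  have hlt : ∀ β, 0 ≤ β → β < βc →
      DriftedWalk.bridgeMass d φ h β < Real.log (DriftedWalk.stepMgf d h) := fun β hβ hlt =>
    DriftedWalk.bridgeMass_lt_log_stepMgf hφ hh.le hβ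
      (hβc ▸ DriftedWalk.strictMonoOn_planeMassZero hφ hβ hβc0.le hlt)
  have hG : ∀ β, 0 ≤ β → β < βc →
      Tendsto (fun N : ℕ => -Real.log (DriftedWalk.G d φ h β N) / N) atTop
        (𝓝 (DriftedWalk.bridgeMass d φ h β)) := fun β hβ hβlt =>
    DriftedWalk.tendsto_log_G hφ hh.le hβ (hlt β hβ hβlt)
  have hGm : ∀ β, 0 ≤ β → β < βc →
      DriftedWalk.pathMass d φ h β = DriftedWalk.bridgeMass d φ h β := fun β hβ hβlt =>
    (hG β hβ hβlt).limUnder_eq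
  refine ⟨fun β hβ hβlt => ⟨by rw [hGm β hβ hβlt]; exact hG β hβ hβlt, (hGm β hβ hβlt).symm⟩,
    fun β₀ hβ₀ hβ₀lt => ?_⟩
  have hs := DriftedWalk.summable_returnProb_div hφ hh.le hβ₀ (hlt β₀ hβ₀ hβ₀lt)
  have hK := DriftedWalk.K_eq hφ hh.le hs
  refine ⟨hK ▸ ENNReal.ofReal_lt_top, fun β hβ hββ₀ N hN => ?_⟩
  rw [hGm β hβ (hββ₀.trans_lt hβ₀lt), hK, ENNReal.toReal_ofReal (sq_nonneg _)]
  have hQ : ∀ N, ∑ n ∈ Finset.range N, DriftedWalk.returnProb d h n / DriftedWalk.B d φ h β n ≤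
      ∑' n, DriftedWalk.returnProb d h n / DriftedWalk.B d φ h β₀ n := fun N =>
    (Finset.sum_le_sum fun n _ => div_le_div_of_nonneg_left
      (DriftedWalk.returnProb_nonneg hh.le n) (DriftedWalk.B_pos hφ hh.le β₀ n)
      (DriftedWalk.B_anti hφ hh.le hβ hββ₀ n)).trans
    (hs.sum_le_tsum _ fun n _ => div_nonneg (DriftedWalk.returnProb_nonneg hh.le n)
      (DriftedWalk.B_pos hφ hh.le β₀ n).le)
  obtain ⟨hQ2, hle⟩ := DriftedWalk.exp_le_B hφ hh.le hβ hQ hN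
  have hB := (div_le_iff₀' hQ2).2 hle
  exact ⟨hB, hB.trans (DriftedWalk.B_le_G hφ hh.le N)⟩
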